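/- A \emph{graph} is a structure $G=\langle V,s_1,s_2,\mathrm{null},\mathrm{root}\rangle$ with $V$ a finite set, $\mathrm{null}\neq\mathrm{root}$ in $V$, and $s_1,s_2\subseteq V\times V$ such that $\langle \mathrm{null},x\rangle\in s_i$ iff $x=\mathrm{null}$ ($i=1,2$). It is a \emph{heap} if $s_1,s_2$ are total functions and every $x\neq\mathrm{null}$ is reachable from $\mathrm{root}$ along $s_1\cup s_2$. It is \emph{orable} if $\langle\mathrm{root},x\rangle\in s_2$ iff $x=\mathrm{null}$. A \emph{homomorphism} $h$ from $G$ to $G'$ preserves $s_1$- and $s_2$-edges and satisfies $h(x)=\mathrm{root}'$ iff $x=\mathrm{root}$, and $h(x)=\mathrm{null}'$ iff $x=\mathrm{null}$; write $G\to G'$ if one exists. The \emph{sum} $G^1+G^2$ of orable graphs, taken with $V^1\cap V^2=\{\mathrm{null},\mathrm{root}\}$, is the graph with node set $V^1\cup V^2$ and edge relations $s_i^1\cup s_i^2$. For $k,n\ge 2$, $0=u_0<u_1<\dots<u_{k-1}<n$ and $0=l_0<l_1<\dots<l_{k-1}<n$, a \emph{corresponder graph} $\mathrm{CG}(n,k,u,l)$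 is a graph isomorphic to the graph with nodes $\mathrm{null},\mathrm{root}$, $C_0,\dots,C_{2k-1}$, $U_0,\dots,U_{2n-1}$, $L_0,\dots,L_{2n-1}$ and, besides the loops at $\mathrm{null}$, exactly the following edges. The $s_1$-edges are $\mathrm{root}\to C_0\to C_1\to\dots\to C_{2k-1}\to\mathrm{null}$, $U_0\to\dots\to U_{2n-1}\to\mathrm{null}$ and $L_0\to\dots\to L_{2n-1}\to\mathrm{null}$. The $s_2$-edges are $\mathrm{root}\to\mathrm{null}$; $C_{2i}\to U_{2u_i}$ and $C_{2i+1}\to L_{2l_i+1}$ for $0\le i<k$; and, for $0\le i<n$, $U_{2i}\to L_{2i}$, $L_{2i+1}\to U_{2i+1}$, $U_{2i+1}\to\mathrm{root}$ if $i\in\{l_0,\dots,l_{k-1}\}$ and $U_{2i+1}\to\mathrm{null}$ otherwise, $L_{2i}\to\mathrm{root}$ if $i\in\{u_0,\dots,u_{k-1}\}$ and $L_{2i}\to\mathrm{null}$ otherwise. \textbf{Proposition.} There exist orable graphs $P$ and $Q_0,\dots,Q_{16}$, with (orable) sum $Q=Q_0+Q_1+\dots+Q_{16}$, such that for every graph $G_0$: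 $G_0$ is a corresponder graph if and only if $G_0$ is a heap with $G_0\to P$ and $G_0\not\to Q$. In particular every corresponder graph is a heap, and for a heap $G_0$ one has ($G_0\to P$ and $G_0\not\to Q$) if and only if $G_0$ is a corresponder graph. -/

import Mathlib

universe u v

/-- A finite graph with two kinds of edges `s1`, `s2` and two distinct constants `null`, `root`;
the only `s1`-successor and the only `s2`-successor of `null` is `null`. -/
structure RootedGraph where
  V : Type u
  finite_V : Finite V
  s1 : V → V → Prop
  s2 : V → V → Prop
  null : V
  root : V
  root_ne_null : root ≠ null
  s1_null : ∀ x, s1 null x ↔ x = null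
  s2_null : ∀ x, s2 null x ↔ x = null

namespace RootedGraph

/-- A heap: both edge relations are total functions and every non-null node is reachable from
the root along edges of either kind. -/
structure IsHeap (G : RootedGraph.{u}) : Prop where
  s1_function : ∀ x, ∃! y, G.s1 x y
  s2_function : ∀ x, ∃! y, G.s2 x y
  reachable : ∀ x, x ≠ G.null →
    Relation.ReflTransGen (fun a b => G.s1 a b ∨ G.s2 a b) G.root x

/-- Homomorphisms of graphs: edges are preserved, and exactly `root` is sent to `root` and
exactly `null` is sent to `null`. -/
structure IsHom (G : RootedGraph.{u}) (H : RootedGraph.{v}) (h : G.V → H.V) : Prop where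
  map_s1 : ∀ x y, G.s1 x y → H.s1 (h x) (h y)
  map_s2 : ∀ x y, G.s2 x y → H.s2 (h x) (h y)
  map_root_iff : ∀ x, h x = H.root ↔ x = G.root
  map_null_iff : ∀ x, h x = H.null ↔ x = G.null

/-- `G → H`: there is a homomorphism from `G` to `H`. -/
def MapsTo (G : RootedGraph.{u}) (H : RootedGraph.{v}) : Prop :=
  ∃ h : G.V → H.V, IsHom G H h

/-- `G` and `H` are isomorphic as relational structures. -/
def IsIsomorphic (G : RootedGraph.{u}) (H : RootedGraph.{v}) : Prop :=
  ∃ e : G.V ≃ H.V,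
    (∀ x y, G.s1 x y ↔ H.s1 (e x) (e y)) ∧
    (∀ x y, G.s2 x y ↔ H.s2 (e x) (e y)) ∧
    e G.root = H.root ∧ e G.null = H.null

/-- A graph is orable if `null` is the one and only `s2`-successor of `root`. -/
def IsOrable (G : RootedGraph.{u}) : Prop :=
  ∀ x, G.s2 G.root x ↔ x = G.null

/-- The nodes of a graph other than `null` and `root`. -/
abbrev Inner (G : RootedGraph.{u}) : Type u :=
  {x : G.V // x ≠ G.null ∧ x ≠ G.root}

/-- The nodes of the sum of `A` and `B`: the disjoint union of the nodes of `A` and of `B`, with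
the two copies of `null` identified and the two copies of `root` identified. -/
inductive SumNode (A B : RootedGraph.{u}) : Type u
  | null : SumNode A B
  | root : SumNode A B
  | left (x : Inner A) : SumNode A B
  | right (x : Inner B) : SumNode A B

open Classical in
/-- The inclusion of the nodes of `A` into the nodes of the sum of `A` and `B`. -/
noncomputable def sumInl (A B : RootedGraph.{u}) (x : A.V) : SumNode A B :=
  if h : x = A.null then .null else if h' : x = A.root then .root else .left ⟨x, h, h'⟩

open Classical in
/-- The inclusion of the nodes of `B` into the nodes of the sum of `A` and `B`. -/
noncomputable def sumInr (A B : RootedGraph.{u}) (x : B.V) : SumNode A B :=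
  if h : x = B.null then .null else if h' : x = B.root then .root else .right ⟨x, h, h'⟩

theorem finite_sumNode (A B : RootedGraph.{u}) : Finite (SumNode A B) := by
  have := A.finite_V
  have := B.finite_V
  let f : SumNode A B → Option (Option (Inner A ⊕ Inner B)) := fun x =>
    match x with
    | .null => none
    | .root => some none
    | .left a => some (some (Sum.inl a))
    | .right b => some (some (Sum.inr b))
  refine Finite.of_injective f ?_
  rintro (_ | _ | x | x) (_ | _ | y | y) h <;> simp_all [f]

theorem sumInl_eq_null_iff (A B : RootedGraph.{u}) (x : A.V) :
    sumInl A B x = .null ↔ x = A.null := by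
  unfold sumInl
  split_ifs <;> simp_all

theorem sumInr_eq_null_iff (A B : RootedGraph.{u}) (x : B.V) :
    sumInr A B x = .null ↔ x = B.null := by
  unfold sumInr
  split_ifs <;> simp_all

/-- The edges of a sum: the union of the two edge relations, carried over by the inclusions. -/
def sumRel (A B : RootedGraph.{u}) (r : A.V → A.V → Prop) (r' : B.V → B.V → Prop)
    (x y : SumNode A B) : Prop :=
  (∃ a a', r a a' ∧ sumInl A B a = x ∧ sumInl A B a' = y) ∨
  (∃ b b', r' b b' ∧ sumInr A B b = x ∧ sumInr A B b' = y)

theorem sumRel_null (A B : RootedGraph.{u}) (r : A.V → A.V → Prop) (r' : B.V → B.V → Prop)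
    (hr : ∀ x, r A.null x ↔ x = A.null) (hr' : ∀ x, r' B.null x ↔ x = B.null)
    (y : SumNode A B) : sumRel A B r r' .null y ↔ y = .null := by
  constructor
  · rintro (⟨a, a', h, h1, h2⟩ | ⟨b, b', h, h1, h2⟩)
    · rw [sumInl_eq_null_iff] at h1
      subst h1
      rw [← h2, sumInl_eq_null_iff]
      exact (hr a').1 h
    · rw [sumInr_eq_null_iff] at h1
      subst h1
      rw [← h2, sumInr_eq_null_iff]
      exact (hr' b').1 h
  · rintro rfl
    exact Or.inl ⟨A.null, A.null, (hr _).2 rfl, (sumInl_eq_null_iff A B _).2 rfl,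
      (sumInl_eq_null_iff A B _).2 rfl⟩

/-- The sum `A + B`: the union of `A` and `B` after they have been made to share exactly `null`
and `root`. -/
noncomputable def sum (A B : RootedGraph.{u}) : RootedGraph.{u} where
  V := SumNode A B
  finite_V := finite_sumNode A B
  s1 := sumRel A B A.s1 B.s1
  s2 := sumRel A B A.s2 B.s2
  null := .null
  root := .root
  root_ne_null := by simp
  s1_null := sumRel_null A B A.s1 B.s1 A.s1_null B.s1_null
  s2_null := sumRel_null A B A.s2 B.s2 A.s2_null B.s2_null

/-- The finite sum `Q 0 + Q 1 + ⋯ + Q m`. -/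
noncomputable def finSum : (m : ℕ) → (Fin (m + 1) → RootedGraph.{u}) → RootedGraph.{u}
  | 0, Q => Q 0
  | m + 1, Q => sum (finSum m (fun i => Q i.castSucc)) (Q (Fin.last (m + 1)))

/-- The nodes `null`, `root`, `C_0, …, C_{2k-1}`, `U_0, …, U_{2n-1}`, `L_0, …, L_{2n-1}` of a
corresponder graph. -/
inductive CNode (n k : ℕ) : Type
  | null : CNode n k
  | root : CNode n k
  | C (i : Fin (2 * k)) : CNode n k
  | U (i : Fin (2 * n)) : CNode n k
  | L (i : Fin (2 * n)) : CNode n k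

theorem finite_cNode (n k : ℕ) : Finite (CNode n k) := by
  let f : CNode n k → Option (Option (Fin (2 * k) ⊕ Fin (2 * n) ⊕ Fin (2 * n))) := fun x =>
    match x with
    | .null => none
    | .root => some none
    | .C i => some (some (Sum.inl i))
    | .U i => some (some (Sum.inr (Sum.inl i)))
    | .L i => some (some (Sum.inr (Sum.inr i)))
  refine Finite.of_injective f ?_
  rintro (_ | _ | x | x | x) (_ | _ | y | y | y) h <;> simp_all [f]

/-- The `s1`-edges of a corresponder graph (with the loop at `null`). -/
inductive CEdge1 (n k : ℕ) : CNode n k → CNode n k → Prop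
  | null : CEdge1 n k .null .null
  | root (h : 0 < 2 * k) : CEdge1 n k .root (.C ⟨0, h⟩)
  | C (i : ℕ) (h : i + 1 < 2 * k) : CEdge1 n k (.C ⟨i, by omega⟩) (.C ⟨i + 1, h⟩)
  | C_last (h : 2 * k - 1 < 2 * k) : CEdge1 n k (.C ⟨2 * k - 1, h⟩) .null
  | U (i : ℕ) (h : i + 1 < 2 * n) : CEdge1 n k (.U ⟨i, by omega⟩) (.U ⟨i + 1, h⟩)
  | U_last (h : 2 * n - 1 < 2 * n) : CEdge1 n k (.U ⟨2 * n - 1, h⟩) .null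
  | L (i : ℕ) (h : i + 1 < 2 * n) : CEdge1 n k (.L ⟨i, by omega⟩) (.L ⟨i + 1, h⟩)
  | L_last (h : 2 * n - 1 < 2 * n) : CEdge1 n k (.L ⟨2 * n - 1, h⟩) .null

/-- The `s2`-edges of a corresponder graph (with the loop at `null`). -/
inductive CEdge2 (n k : ℕ) (u l : Fin k → Fin n) : CNode n k → CNode n k → Prop
  | null : CEdge2 n k u l .null .null
  | root : CEdge2 n k u l .root .null
  | C_even (i : Fin k) :
      CEdge2 n k u l (.C ⟨2 * (i : ℕ), by omega⟩) (.U ⟨2 * (u i : ℕ), by omega⟩)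
  | C_odd (i : Fin k) :
      CEdge2 n k u l (.C ⟨2 * (i : ℕ) + 1, by omega⟩) (.L ⟨2 * (l i : ℕ) + 1, by omega⟩)
  | U_even (i : Fin n) :
      CEdge2 n k u l (.U ⟨2 * (i : ℕ), by omega⟩) (.L ⟨2 * (i : ℕ), by omega⟩)
  | L_odd (i : Fin n) :
      CEdge2 n k u l (.L ⟨2 * (i : ℕ) + 1, by omega⟩) (.U ⟨2 * (i : ℕ) + 1, by omega⟩)
  | U_odd_null (i : Fin n) (h : ∀ j, l j ≠ i) :
      CEdge2 n k u l (.U ⟨2 * (i : ℕ) + 1, by omega⟩) .null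
  | U_odd_root (j : Fin k) :
      CEdge2 n k u l (.U ⟨2 * (l j : ℕ) + 1, by omega⟩) .root
  | L_even_null (i : Fin n) (h : ∀ j, u j ≠ i) :
      CEdge2 n k u l (.L ⟨2 * (i : ℕ), by omega⟩) .null
  | L_even_root (j : Fin k) :
      CEdge2 n k u l (.L ⟨2 * (u j : ℕ), by omega⟩) .root

/-- The standard corresponder graph with parameters `n`, `k`, `u`, `l`. -/
def corresponderGraph (n k : ℕ) (u l : Fin k → Fin n) : RootedGraph.{0} where
  V := CNode n k
  finite_V := finite_cNode n k
  s1 := CEdge1 n k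
  s2 := CEdge2 n k u l
  null := .null
  root := .root
  root_ne_null := by simp
  s1_null := fun x => by
    constructor
    · rintro ⟨⟩
      rfl
    · rintro rfl
      exact .null
  s2_null := fun x => by
    constructor
    · rintro ⟨⟩
      rfl
    · rintro rfl
      exact .null

/-- A corresponder graph: a graph isomorphic to the standard one for some `k, n ≥ 2` and
`0 = u_0 < u_1 < ⋯ < u_{k-1} < n`, `0 = l_0 < l_1 < ⋯ < l_{k-1} < n`. -/
def IsCorresponder (G : RootedGraph.{u}) : Prop :=
  ∃ (n k : ℕ) (_ : 2 ≤ n) (hk : 2 ≤ k) (u l : Fin k → Fin n),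
    (u ⟨0, by omega⟩ : ℕ) = 0 ∧ StrictMono u ∧
    (l ⟨0, by omega⟩ : ℕ) = 0 ∧ StrictMono l ∧
    IsIsomorphic G (corresponderGraph n k u l)

end RootedGraph

/-!
The graph `P` (`colourGraph`) is a folded corresponder graph: a heap that maps to it has nodes of
the sorts `C`, `U`, `L`, each with even or odd index, and its edges join the sorts in the right way
(`exists_isLayered`). Let `f` and `g` be the successor functions of such a heap and put `Cᵢ = fⁱ⁺¹
root`, `Uᵢ = fⁱ (g C₀)` and `Lᵢ = fⁱ (g U₀)`. The heap is a corresponder graph as soon as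

* the paths `C` and `U` reach `null`;
* `g C₁ = L₁`, and `g L₂ᵢ₊₁ = U₂ᵢ₊₁` and `f L₂ᵢ₊₁ = g U₂ᵢ₊₂` for all `i`, whence by induction
  `L₂ᵢ = g U₂ᵢ` and `L` is as long as `U`;
* `g C₂ᵢ₊₂` is the first high node after `g C₂ᵢ` among the `U₂ₜ`, and is `null` if there is none,
  where a node `x` is high if `g (g x) = root`; and likewise for the odd `C` and the odd `L`.

The last condition says that the values `g C₂ᵢ` enumerate the high nodes in increasing order, so
that their indices form the sequence `u`, and similarly for `l` (`exists_strictMono_index`). Since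
every node is reachable from `root`, and the nodes found so far are closed under `f` and `g`, there
are no others (`isCorresponder_of_equations`).

The failure of each condition is the existence of a homomorphism to a finite graph. The inner nodes
of that graph are sets of marks, and its edges are those that respect a list of implications between
the marks at the two ends (`Obstruction`). A failure at a certain node is exhibited by marking this
node `pick`, the part of its path before it `chain0` or `chain1`, and the nodes on the two sides of
the failing equation `f ⋯ = g ⋯`: the value of one side is marked `goal`, and the value of the other
is required not to be (`mapsTo_badOdd`, `mapsTo_badEven`, `mapsTo_badNext`). If the marked value may
be `null`, whose marks are fixed by the graph, one graph is needed for the case that it is `null`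
and one for the case that it is not. Conversely, the chain
marks of a corresponder graph cannot continue up to `null`, so some node is picked, and the
implications propagate the marks from it to a contradiction (`not_isSeqMarking_badNext_true` and its
companions).

Finally, a homomorphism from a heap to a sum of orable graphs, where the `s1`-successor of `root` is
an inner node, sends all inner nodes into one summand (`exists_mapsTo_of_finSum`). So mapping to
`Q` is the same as satisfying one of the obstructions.
-/

universe w

namespace RootedGraph

/-! ### Homomorphisms into sums -/

theorem sumInl_eq_root_iff (A B : RootedGraph.{u}) (x : A.V) :
    sumInl A B x = .root ↔ x = A.root := by
  have := A.root_ne_null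
  unfold sumInl
  split_ifs <;> simp_all [eq_comm]

theorem sumInr_eq_root_iff (A B : RootedGraph.{u}) (x : B.V) :
    sumInr A B x = .root ↔ x = B.root := by
  have := B.root_ne_null
  unfold sumInr
  split_ifs <;> simp_all [eq_comm]

theorem sumInl_ne_right {A B : RootedGraph.{u}} (x : A.V) (y : Inner B) :
    sumInl A B x ≠ .right y := by
  unfold sumInl
  split_ifs <;> simp

theorem sumInr_ne_left {A B : RootedGraph.{u}} (x : B.V) (y : Inner A) :
    sumInr A B x ≠ .left y := by
  unfold sumInr
  split_ifs <;> simp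

theorem IsHom.comp {G : RootedGraph.{u}} {H : RootedGraph.{v}} {K : RootedGraph.{w}}
    {h : G.V → H.V} {h' : H.V → K.V} (hh' : IsHom H K h') (hh : IsHom G H h) :
    IsHom G K (h' ∘ h) where
  map_s1 x y e := hh'.map_s1 _ _ (hh.map_s1 x y e)
  map_s2 x y e := hh'.map_s2 _ _ (hh.map_s2 x y e)
  map_root_iff x := (hh'.map_root_iff _).trans (hh.map_root_iff x)
  map_null_iff x := (hh'.map_null_iff _).trans (hh.map_null_iff x)

theorem MapsTo.trans {G : RootedGraph.{u}} {H : RootedGraph.{v}} {K : RootedGraph.{w}}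
    (h : G.MapsTo H) (h' : H.MapsTo K) : G.MapsTo K := by
  obtain ⟨f, hf⟩ := h
  obtain ⟨g, hg⟩ := h'
  exact ⟨g ∘ f, hg.comp hf⟩

theorem mapsTo_sum_left (A B : RootedGraph.{u}) : A.MapsTo (sum A B) :=
  ⟨sumInl A B, fun x y h => Or.inl ⟨x, y, h, rfl, rfl⟩, fun x y h => Or.inl ⟨x, y, h, rfl, rfl⟩,
    sumInl_eq_root_iff A B, sumInl_eq_null_iff A B⟩

theorem mapsTo_sum_right (A B : RootedGraph.{u}) : B.MapsTo (sum A B) :=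
  ⟨sumInr A B, fun x y h => Or.inr ⟨x, y, h, rfl, rfl⟩, fun x y h => Or.inr ⟨x, y, h, rfl, rfl⟩,
    sumInr_eq_root_iff A B, sumInr_eq_null_iff A B⟩

theorem mapsTo_finSum (m : ℕ) (Q : Fin (m + 1) → RootedGraph.{u}) (i : Fin (m + 1)) :
    (Q i).MapsTo (finSum m Q) := by
  induction m with
  | zero =>
    obtain rfl : i = 0 := Fin.fin_one_eq_zero i
    exact ⟨id, fun _ _ h => h, fun _ _ h => h, fun _ => Iff.rfl, fun _ => Iff.rfl⟩
  | succ m ih =>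
    refine Fin.lastCases ?_ (fun j => ?_) i
    · exact mapsTo_sum_right _ _
    · exact (ih (fun i => Q i.castSucc) j).trans (mapsTo_sum_left _ _)

theorem IsOrable.sum {A B : RootedGraph.{u}} (hA : A.IsOrable) (hB : B.IsOrable) :
    (sum A B).IsOrable := by
  intro y
  constructor
  · rintro (⟨a, a', h, h1, h2⟩ | ⟨b, b', h, h1, h2⟩)
    · rw [← h2]
      rw [(sumInl_eq_root_iff A B a).1 h1] at h
      exact (sumInl_eq_null_iff A B a').2 ((hA a').1 h)
    · rw [← h2]
      rw [(sumInr_eq_root_iff A B b).1 h1] at h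
      exact (sumInr_eq_null_iff A B b').2 ((hB b').1 h)
  · rintro rfl
    exact Or.inl ⟨A.root, A.null, (hA _).2 rfl, (sumInl_eq_root_iff A B _).2 rfl,
      (sumInl_eq_null_iff A B _).2 rfl⟩

theorem isOrable_finSum (m : ℕ) (Q : Fin (m + 1) → RootedGraph.{u}) (h : ∀ i, (Q i).IsOrable) :
    (finSum m Q).IsOrable := by
  induction m with
  | zero => exact h 0
  | succ m ih => exact (ih _ fun i => h i.castSucc).sum (h _)

/-- The exchange of the two summands of a sum. -/
def SumNode.swap {A B : RootedGraph.{u}} : SumNode A B → SumNode B A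
  | .null => .null
  | .root => .root
  | .left a => .right a
  | .right b => .left b

theorem isHom_swap (A B : RootedGraph.{u}) : IsHom (sum A B) (sum B A) SumNode.swap := by
  have hl : ∀ a, (sumInl A B a).swap = sumInr B A a := by
    intro a
    unfold sumInl sumInr
    split_ifs <;> rfl
  have hr : ∀ b, (sumInr A B b).swap = sumInl B A b := by
    intro b
    unfold sumInl sumInr
    split_ifs <;> rfl
  refine ⟨?_, ?_, ?_, ?_⟩
  · rintro _ _ (⟨a, a', h, rfl, rfl⟩ | ⟨b, b', h, rfl, rfl⟩)
    · exact Or.inr ⟨a, a', h, (hl a).symm, (hl a').symm⟩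
    · exact Or.inl ⟨b, b', h, (hr b).symm, (hr b').symm⟩
  · rintro _ _ (⟨a, a', h, rfl, rfl⟩ | ⟨b, b', h, rfl, rfl⟩)
    · exact Or.inr ⟨a, a', h, (hl a).symm, (hl a').symm⟩
    · exact Or.inl ⟨b, b', h, (hr b).symm, (hr b').symm⟩
  · rintro (_ | _ | a | b) <;> simp [SumNode.swap, sum]
  · rintro (_ | _ | a | b) <;> simp [SumNode.swap, sum]

/-- In a heap whose root has an inner `s1`-successor, every inner node is reached from that
successor without passing through `root` or `null`, so its image stays in one summand. -/
theorem mapsTo_left_of_isHom_sum {G : RootedGraph.{u}} {A B : RootedGraph.{v}} (hG : G.IsHeap)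
    (hA : A.IsOrable) (h2 : G.s2 G.root G.null) {c : G.V}
    (hc : G.s1 G.root c) (hc_root : c ≠ G.root) (hc_null : c ≠ G.null)
    {h : G.V → SumNode A B} (hh : IsHom G (sum A B) h) {a : Inner A} (hca : h c = .left a) :
    G.MapsTo A := by
  have hnull : ∀ x, h x = .null ↔ x = G.null := hh.map_null_iff
  have hroot : ∀ x, h x = .root ↔ x = G.root := hh.map_root_iff
  have f1 : ∀ {x y z}, G.s1 x y → G.s1 x z → y = z := fun hy hz =>
    (hG.s1_function _).unique hy hz
  have f2 : ∀ {x y z}, G.s2 x y → G.s2 x z → y = z := fun hy hz =>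
    (hG.s2_function _).unique hy hz
  have step : ∀ {r : A.V → A.V → Prop} {r' : B.V → B.V → Prop} {x y : G.V} {a : Inner A}
      {b : Inner B}, h x = .left a → h y = .right b → ¬ sumRel A B r r' (h x) (h y) := by
    intro r r' x y a b hx hy
    rw [hx, hy]
    rintro (⟨p, q, -, -, h⟩ | ⟨p, q, -, h, -⟩)
    · exact sumInl_ne_right _ _ h
    · exact sumInr_ne_left _ _ h
  have main : ∀ x, x ≠ G.null → ∀ b, h x ≠ .right b := by
    intro x hx
    have := hG.reachable x hx
    clear hx
    induction this with
    | refl =>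
      intro b hb
      rw [(hroot _).2 rfl] at hb
      cases hb
    | @tail y z _ hyz ih =>
      intro b hb
      rcases hy : h y with _ | _ | a' | b'
      · rw [hnull] at hy
        subst hy
        rw [G.s1_null, G.s2_null, or_self] at hyz
        rw [(hnull _).2 hyz] at hb
        cases hb
      · rw [hroot] at hy
        subst hy
        rcases hyz with hyz | hyz
        · rw [← f1 hc hyz, hca] at hb
          cases hb
        · rw [(hnull _).2 (f2 hyz h2)] at hb
          cases hb
      · rcases hyz with hyz | hyz
        · exact step hy hb (hh.map_s1 _ _ hyz)
        · exact step hy hb (hh.map_s2 _ _ hyz)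
      · exact ih b' hy
  have main' : ∀ x b, h x ≠ .right b := by
    intro x b hb
    refine main x ?_ b hb
    rintro rfl
    rw [(hnull _).2 rfl] at hb
    cases hb
  let s : SumNode A B → A.V := fun x =>
    match x with
    | .null => A.null
    | .root => A.root
    | .left a => a
    | .right _ => A.null
  have hs : ∀ a, s (sumInl A B a) = a := by
    intro a
    unfold sumInl
    split_ifs with h1 h2
    · exact h1.symm
    · exact h2.symm
    · rfl
  -- an edge between images that comes from `B` joins copies of `null` and `root`
  have key : ∀ b x, sumInr A B b = h x →
      (b = B.null ∧ x = G.null) ∨ (b = B.root ∧ x = G.root) := by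
    intro b x hb
    rcases hx : h x with _ | _ | a' | b'
    · exact Or.inl ⟨(sumInr_eq_null_iff A B b).1 (hb.trans hx), (hnull x).1 hx⟩
    · exact Or.inr ⟨(sumInr_eq_root_iff A B b).1 (hb.trans hx), (hroot x).1 hx⟩
    · exact absurd (hb.trans hx) (sumInr_ne_left _ _)
    · exact absurd hx (main' _ _)
  have snull : s (h G.null) = A.null := by rw [(hnull _).2 rfl]
  have sroot : s (h G.root) = A.root := by rw [(hroot _).2 rfl]
  refine ⟨fun x => s (h x), ?_, ?_, ?_, ?_⟩
  · intro x y hxy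
    rcases hh.map_s1 x y hxy with ⟨p, q, hpq, hp, hq⟩ | ⟨p, q, hpq, hp, hq⟩
    · simp only [← hp, ← hq, hs]
      exact hpq
    · rcases key _ _ hp with ⟨rfl, rfl⟩ | ⟨rfl, rfl⟩
      · rw [(G.s1_null y).1 hxy]
        simp only [snull]
        exact (A.s1_null _).2 rfl
      · rw [← f1 hc hxy] at hq
        rcases key _ _ hq with ⟨_, h⟩ | ⟨_, h⟩
        · exact absurd h hc_null
        · exact absurd h hc_root
  · intro x y hxy
    rcases hh.map_s2 x y hxy with ⟨p, q, hpq, hp, hq⟩ | ⟨p, q, hpq, hp, hq⟩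
    · simp only [← hp, ← hq, hs]
      exact hpq
    · rcases key _ _ hp with ⟨rfl, rfl⟩ | ⟨rfl, rfl⟩
      · rw [(G.s2_null y).1 hxy]
        simp only [snull]
        exact (A.s2_null _).2 rfl
      · rw [← f2 h2 hxy]
        simp only [snull, sroot]
        exact (hA _).2 rfl
  · intro x
    rw [← hroot x]
    rcases hx : h x with _ | _ | a' | b'
    · simp [s, A.root_ne_null.symm]
    · simp [s]
    · simp [s, a'.2.2]
    · exact absurd hx (main' _ _)
  · intro x
    rw [← hnull x]
    rcases hx : h x with _ | _ | a' | b'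
    · simp [s]
    · simp [s, A.root_ne_null]
    · simp [s, a'.2.1]
    · exact absurd hx (main' _ _)

theorem mapsTo_sum_cases {G : RootedGraph.{u}} {A B : RootedGraph.{v}} (hG : G.IsHeap)
    (hA : A.IsOrable) (hB : B.IsOrable) (h2 : G.s2 G.root G.null) {c : G.V}
    (hc : G.s1 G.root c) (hc_root : c ≠ G.root) (hc_null : c ≠ G.null)
    (h : G.MapsTo (sum A B)) : G.MapsTo A ∨ G.MapsTo B := by
  obtain ⟨h, hh⟩ := h
  rcases hx : h c with _ | _ | a | b
  · exact absurd ((hh.map_null_iff c).1 hx) hc_null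
  · exact absurd ((hh.map_root_iff c).1 hx) hc_root
  · exact Or.inl (mapsTo_left_of_isHom_sum hG hA h2 hc hc_root hc_null hh hx)
  · refine Or.inr (mapsTo_left_of_isHom_sum hG hB h2 hc hc_root hc_null
      ((isHom_swap A B).comp hh) (a := b) ?_)
    show SumNode.swap (h c) = _
    rw [hx]
    rfl

/-- A homomorphism from a suitable heap to a finite sum factors through one of the summands. -/
theorem exists_mapsTo_of_finSum {G : RootedGraph.{u}} (hG : G.IsHeap)
    (h2 : G.s2 G.root G.null) {c : G.V} (hc : G.s1 G.root c) (hc_root : c ≠ G.root)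
    (hc_null : c ≠ G.null) (m : ℕ) (Q : Fin (m + 1) → RootedGraph.{v})
    (hQ : ∀ i, (Q i).IsOrable) (h : G.MapsTo (finSum m Q)) : ∃ i, G.MapsTo (Q i) := by
  induction m with
  | zero => exact ⟨0, h⟩
  | succ m ih =>
    rcases mapsTo_sum_cases hG (isOrable_finSum m _ fun i => hQ i.castSucc) (hQ _) h2 hc
      hc_root hc_null h with h | h
    · obtain ⟨i, hi⟩ := ih _ (fun i => hQ i.castSucc) h
      exact ⟨_, hi⟩
    · exact ⟨_, h⟩

/-! ### Isomorphic copies -/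

theorem IsIsomorphic.isHom {G : RootedGraph.{u}} {H : RootedGraph.{v}} {e : G.V ≃ H.V}
    (h1 : ∀ x y, G.s1 x y ↔ H.s1 (e x) (e y)) (h2 : ∀ x y, G.s2 x y ↔ H.s2 (e x) (e y))
    (hr : e G.root = H.root) (hn : e G.null = H.null) : IsHom G H e where
  map_s1 x y := (h1 x y).1
  map_s2 x y := (h2 x y).1
  map_root_iff x := by rw [← hr, e.apply_eq_iff_eq]
  map_null_iff x := by rw [← hn, e.apply_eq_iff_eq]

theorem IsIsomorphic.symm {G : RootedGraph.{u}} {H : RootedGraph.{v}} (h : G.IsIsomorphic H) :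
    H.IsIsomorphic G := by
  obtain ⟨e, h1, h2, hr, hn⟩ := h
  exact ⟨e.symm, fun x y => by simp [h1], fun x y => by simp [h2], by simp [← hr], by simp [← hn]⟩

theorem IsIsomorphic.mapsTo {G : RootedGraph.{u}} {H : RootedGraph.{v}}
    (h : G.IsIsomorphic H) : G.MapsTo H := by
  obtain ⟨e, h1, h2, hr, hn⟩ := h
  exact ⟨e, IsIsomorphic.isHom h1 h2 hr hn⟩

theorem IsIsomorphic.isHeap {G : RootedGraph.{u}} {H : RootedGraph.{v}}
    (h : G.IsIsomorphic H) (hH : H.IsHeap) : G.IsHeap := by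
  obtain ⟨e, h1, h2, hr, hn⟩ := h
  refine ⟨fun x => ?_, fun x => ?_, fun x hx => ?_⟩
  · obtain ⟨y, hy, huniq⟩ := hH.s1_function (e x)
    exact ⟨e.symm y, by simpa [h1] using hy,
      fun z hz => by rw [e.eq_symm_apply]; exact huniq _ ((h1 _ _).1 hz)⟩
  · obtain ⟨y, hy, huniq⟩ := hH.s2_function (e x)
    exact ⟨e.symm y, by simpa [h2] using hy,
      fun z hz => by rw [e.eq_symm_apply]; exact huniq _ ((h2 _ _).1 hz)⟩
  · have := hH.reachable (e x) (by rwa [← hn, Ne, e.apply_eq_iff_eq])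
    have := this.lift (p := fun a b => G.s1 a b ∨ G.s2 a b) e.symm
      (fun a b hab => by simpa [Function.onFun, h1, h2] using hab)
    simpa [Function.onFun, ← hr] using this

/-! ### Graphs given by rules -/

/-- The type `T` with two further points, which serve as `null` and `root` of a graph. -/
inductive Pointed (T : Type) : Type
  | null : Pointed T
  | root : Pointed T
  | inner (t : T) : Pointed T

theorem finite_pointed (T : Type) [Finite T] : Finite (Pointed T) := by
  let f : Pointed T → Option (Option T) := fun x =>
    match x with
    | .null => none
    | .root => some none
    | .inner t => some (some t)
  refine Finite.of_injective f ?_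
  rintro (_ | _ | x) (_ | _ | y) h <;> simp_all [f]

/-- The `s1`-edges of `ofRules`. -/
def ruleEdge1 {T : Type} (start : T → Prop) (e : T → Pointed T → Prop) :
    Pointed T → Pointed T → Prop
  | .null, y => y = .null
  | .root, y => ∃ t, start t ∧ y = .inner t
  | .inner t, y => e t y

/-- The `s2`-edges of `ofRules`. -/
def ruleEdge2 {T : Type} (e : T → Pointed T → Prop) : Pointed T → Pointed T → Prop
  | .null, y => y = .null
  | .root, y => y = .null
  | .inner t, y => e t y

/-- The orable graph with inner nodes `T` in which the `s1`-successors of `root` are the inner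
nodes satisfying `start`, and the edges that leave inner nodes are given by `e1` and `e2`. -/
def ofRules (T : Type) [Finite T] (start : T → Prop) (e1 e2 : T → Pointed T → Prop) :
    RootedGraph.{0} where
  V := Pointed T
  finite_V := finite_pointed T
  s1 := ruleEdge1 start e1
  s2 := ruleEdge2 e2
  null := .null
  root := .root
  root_ne_null := by simp
  s1_null := fun _ => Iff.rfl
  s2_null := fun _ => Iff.rfl

theorem isOrable_ofRules (T : Type) [Finite T] (start : T → Prop) (e1 e2 : T → Pointed T → Prop) :
    (ofRules T start e1 e2).IsOrable :=
  fun _ => Iff.rfl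

/-! ### Obstructions: existential conditions with local rules on sets of marks -/

/-- The marks that an obstruction may put on the nodes of a heap. A node may carry several
marks. -/
inductive Mark : Type
  | atNull | atRoot | first | chain0 | chain1 | pick | pick1 | scan0 | scan1 | probe | goal
  | other | high0 | high1 | low0 | low1
  deriving DecidableEq

instance : Fintype Mark where
  elems := {.atNull, .atRoot, .first, .chain0, .chain1, .pick, .pick1, .scan0, .scan1, .probe,
    .goal, .other, .high0, .high1, .low0, .low1}
  complete x := by cases x <;> decide

/-- An obstruction asks for sets of marks on the nodes such that `null` carries `nullMarks`, `root`
carries only `atRoot`, the marks of the `s1`-successor of `root` satisfy `start`, and the marks at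
the two ends of an `s1`-edge (`s2`-edge) leaving an inner node are related by `rule1` (`rule2`). -/
structure Obstruction where
  nullMarks : Set Mark
  start : Set Mark → Prop
  rule1 : Set Mark → Set Mark → Prop
  rule2 : Set Mark → Set Mark → Prop

namespace Obstruction

/-- The marks at a node of the graph of an obstruction. -/
def marks (R : Obstruction) : Pointed (Set Mark) → Set Mark
  | .null => R.nullMarks
  | .root => {.atRoot}
  | .inner A => A

/-- The graph to which exactly the marked heaps map: its inner nodes are the sets of marks. -/
def graph (R : Obstruction) : RootedGraph.{0} :=
  ofRules (Set Mark) R.start (fun A y => R.rule1 A (R.marks y)) (fun A y => R.rule2 A (R.marks y))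

/-- Marks on the nodes of `G` that obey the rules of the obstruction. -/
structure IsMarking (R : Obstruction) (G : RootedGraph.{u}) (c : G.V → Set Mark) : Prop where
  null : c G.null = R.nullMarks
  root : c G.root = {.atRoot}
  start : ∀ x, G.s1 G.root x → R.start (c x)
  rule1 : ∀ x y, x ≠ G.null → x ≠ G.root → G.s1 x y → R.rule1 (c x) (c y)
  rule2 : ∀ x y, x ≠ G.null → x ≠ G.root → G.s2 x y → R.rule2 (c x) (c y)

theorem exists_isMarking_of_mapsTo {R : Obstruction} {G : RootedGraph.{u}}
    (h : G.MapsTo R.graph) : ∃ c, R.IsMarking G c := by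
  obtain ⟨h, hh⟩ := h
  have hinner : ∀ x, x ≠ G.null → x ≠ G.root → ∃ A, h x = .inner A := by
    intro x h1 h2
    rcases hx : h x with _ | _ | A
    · exact absurd ((hh.map_null_iff x).1 hx) h1
    · exact absurd ((hh.map_root_iff x).1 hx) h2
    · exact ⟨A, rfl⟩
  have hnull : h G.null = .null := (hh.map_null_iff _).2 rfl
  have hroot : h G.root = .root := (hh.map_root_iff _).2 rfl
  refine ⟨fun x => R.marks (h x), ?_, ?_, ?_, ?_, ?_⟩
  · simp [hnull, marks]
  · simp [hroot, marks]
  · intro x hx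
    have := hh.map_s1 _ _ hx
    rw [hroot] at this
    obtain ⟨t, ht, hxt⟩ := this
    simpa [hxt, marks] using ht
  · intro x y h1 h2 hxy
    obtain ⟨A, hA⟩ := hinner x h1 h2
    have := hh.map_s1 _ _ hxy
    rw [hA] at this
    simp only [hA]
    exact this
  · intro x y h1 h2 hxy
    obtain ⟨A, hA⟩ := hinner x h1 h2
    have := hh.map_s2 _ _ hxy
    rw [hA] at this
    simp only [hA]
    exact this

end Obstruction

/-- `f` and `g` are the successor functions of `G`, and the edges of `root` are as in a heap that
maps to an orable graph in which `root` has only inner `s1`-successors. -/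
structure IsFunctional (G : RootedGraph.{u}) (f g : G.V → G.V) : Prop where
  s1_iff : ∀ x y, G.s1 x y ↔ f x = y
  s2_iff : ∀ x y, G.s2 x y ↔ g x = y
  g_root : g G.root = G.null
  f_root_ne_null : f G.root ≠ G.null
  f_root_ne_root : f G.root ≠ G.root

open Classical in
/-- The marks of a node when the marks of `null` and `root` are prescribed and an inner node `x`
carries the marks `a` with `p a x`. -/
def valuation (G : RootedGraph.{u}) (N : Set Mark) (p : Mark → G.V → Prop) (x : G.V) : Set Mark :=
  if x = G.null then N else if x = G.root then {.atRoot} else {a | p a x}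

theorem valuation_null (G : RootedGraph.{u}) (N : Set Mark) (p : Mark → G.V → Prop) :
    valuation G N p G.null = N := by
  simp [valuation]

theorem valuation_root (G : RootedGraph.{u}) (N : Set Mark) (p : Mark → G.V → Prop) :
    valuation G N p G.root = {.atRoot} := by
  simp [valuation, G.root_ne_null]

theorem mem_valuation {G : RootedGraph.{u}} {N : Set Mark} {p : Mark → G.V → Prop} {x : G.V}
    (h1 : x ≠ G.null) (h2 : x ≠ G.root) {a : Mark} : a ∈ valuation G N p x ↔ p a x := by
  simp [valuation, h1, h2]

theorem Obstruction.mapsTo_of_valuation {G : RootedGraph.{u}} {f g : G.V → G.V}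
    (hG : G.IsFunctional f g) (R : Obstruction) (p : Mark → G.V → Prop)
    (hs : R.start (valuation G R.nullMarks p (f G.root)))
    (h : ∀ x, x ≠ G.null → x ≠ G.root →
      R.rule1 (valuation G R.nullMarks p x) (valuation G R.nullMarks p (f x)) ∧
      R.rule2 (valuation G R.nullMarks p x) (valuation G R.nullMarks p (g x))) :
    G.MapsTo R.graph := by
  classical
  set c := valuation G R.nullMarks p with hc
  let k : G.V → Pointed (Set Mark) := fun x =>
    if x = G.null then .null else if x = G.root then .root else .inner (c x)
  have hk : ∀ x, R.marks (k x) = c x := by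
    intro x
    by_cases h1 : x = G.null
    · subst h1
      simp [k, marks, hc, valuation_null]
    by_cases h2 : x = G.root
    · subst h2
      simp [k, marks, hc, valuation_root, G.root_ne_null]
    simp [k, h1, h2, marks]
  have knull : k G.null = .null := by simp [k]
  have kroot : k G.root = .root := by simp [k, G.root_ne_null]
  have kinner : ∀ x, x ≠ G.null → x ≠ G.root → k x = .inner (c x) := by
    intro x h1 h2
    simp [k, h1, h2]
  refine ⟨k, ?_, ?_, ?_, ?_⟩
  · intro x y hxy
    by_cases h1 : x = G.null
    · subst h1
      rw [(G.s1_null y).1 hxy, knull]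
      rfl
    rw [hG.s1_iff] at hxy
    subst hxy
    by_cases h2 : x = G.root
    · subst h2
      rw [kroot]
      exact ⟨_, hs, kinner _ hG.f_root_ne_null hG.f_root_ne_root⟩
    rw [kinner x h1 h2]
    show R.rule1 _ (R.marks (k (f x)))
    rw [hk]
    exact (h x h1 h2).1
  · intro x y hxy
    by_cases h1 : x = G.null
    · subst h1
      rw [(G.s2_null y).1 hxy, knull]
      rfl
    rw [hG.s2_iff] at hxy
    subst hxy
    by_cases h2 : x = G.root
    · subst h2
      rw [kroot, hG.g_root, knull]
      rfl
    rw [kinner x h1 h2]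
    show R.rule2 _ (R.marks (k (g x)))
    rw [hk]
    exact (h x h1 h2).2
  · intro x
    show k x = .root ↔ _
    have := G.root_ne_null
    simp only [k]
    split_ifs <;> simp_all [eq_comm]
  · intro x
    show k x = .null ↔ _
    simp only [k]
    split_ifs <;> simp_all

/-! ### The obstructions -/

namespace Obstruction

/-- The `s1`-path from `root` never reaches `null`: its inner nodes are marked `chain0`. -/
def unendingC : Obstruction where
  nullMarks := ∅
  start A := .chain0 ∈ A
  rule1 A B := .chain0 ∈ A → .chain0 ∈ B
  rule2 _ _ := True

/-- The `s1`-path from `U₀`, the `s2`-successor of `C₀`, never reaches `null`. -/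
def unendingU : Obstruction where
  nullMarks := ∅
  start A := .first ∈ A
  rule1 A B := .chain0 ∈ A → .chain0 ∈ B
  rule2 A B := .first ∈ A → .chain0 ∈ B

/-- The `s2`-successor of `C₁` is not `L₁`: the path `C₀`, `U₀`, `L₀`, `L₁` is marked `first`,
`scan0`, `scan1`, `goal`, and `C₁` is marked `other`. -/
def badBase : Obstruction where
  nullMarks := ∅
  start A := .first ∈ A
  rule1 A B := (.first ∈ A → .other ∈ B) ∧ (.scan1 ∈ A → .goal ∈ B)
  rule2 A B := (.first ∈ A → .scan0 ∈ B) ∧ (.scan0 ∈ A → .scan1 ∈ B) ∧ (.other ∈ A → .goal ∉ B)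

/-- For some `i`, marked by `pick` at `U₂ᵢ`, the `s2`-successor of `L₂ᵢ₊₁` is not `U₂ᵢ₊₁`. Here
`scan0` and `scan1` mark `L₂ᵢ` and `L₂ᵢ₊₁`, and `goal` marks `U₂ᵢ₊₁`. -/
def badOdd : Obstruction where
  nullMarks := ∅
  start A := .first ∈ A
  rule1 A B := (.chain0 ∈ A → .chain1 ∈ B) ∧ (.chain1 ∈ A → .chain0 ∈ B ∨ .pick ∈ B) ∧
    (.pick ∈ A → .goal ∈ B) ∧ (.scan0 ∈ A → .scan1 ∈ B)
  rule2 A B := (.first ∈ A → .chain0 ∈ B ∨ .pick ∈ B) ∧ (.pick ∈ A → .scan0 ∈ B) ∧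
    (.scan1 ∈ A → .goal ∉ B)

/-- For some `i`, marked by `pick` at `U₂ᵢ`, the `s1`-successor of `L₂ᵢ₊₁` is not the
`s2`-successor of `U₂ᵢ₊₂`; the former is `null` if and only if `β` holds. Here `scan0`, `scan1`
and `goal` mark `L₂ᵢ`, `L₂ᵢ₊₁` and its `s1`-successor, and `pick1` and `other` mark `U₂ᵢ₊₁` and its
`s1`-successor. -/
def badEven (β : Bool) : Obstruction where
  nullMarks := {a | if β then a = .goal else a = .other}
  start A := .first ∈ A
  rule1 A B := (.chain0 ∈ A → .chain1 ∈ B) ∧ (.chain1 ∈ A → .chain0 ∈ B ∨ .pick ∈ B) ∧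
    (.pick ∈ A → .pick1 ∈ B) ∧ (.pick1 ∈ A → .other ∈ B) ∧
    (.scan0 ∈ A → .scan1 ∈ B) ∧ (.scan1 ∈ A → .goal ∈ B)
  rule2 A B := (.first ∈ A → .chain0 ∈ B ∨ .pick ∈ B) ∧ (.pick ∈ A → .scan0 ∈ B) ∧
    (.other ∈ A → .goal ∉ B)

/-- Every second node `D₀, D₁, …` of the path `C₀, C₁, …` is considered, from `C₀` on if `σ` holds
and from `C₁` on otherwise, and some `Dᵢ` is marked `pick`. From the `s2`-successor of `Dᵢ` every
second node is scanned until a node is found that is high, that is, from which two `s2`-steps lead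
to `root`, or until `null` is reached (if `β` holds). This target is marked `goal`, and it is not
the `s2`-successor of `Dᵢ₊₁`, which is marked `other`.

Moreover `null` carries `scan1` if `β` holds and `pick1` otherwise, because a path that is considered
or scanned at its odd nodes ends right after such a node. -/
def badNext (σ β : Bool) : Obstruction where
  nullMarks := {a | a = .atNull ∨
    if β then a = .scan1 ∨ a = .probe ∨ a = .goal else a = .pick1 ∨ a = .other}
  start A := if σ then .chain0 ∈ A ∨ .pick ∈ A else .chain1 ∈ A
  rule1 A B := (.chain0 ∈ A → .chain1 ∈ B) ∧ (.chain1 ∈ A → .chain0 ∈ B ∨ .pick ∈ B) ∧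
    (.pick ∈ A → .pick1 ∈ B) ∧ (.pick1 ∈ A → .other ∈ B) ∧
    (.scan0 ∈ A → .scan1 ∈ B) ∧ (.scan1 ∈ A → .probe ∈ B)
  rule2 A B := (.pick ∈ A → .scan0 ∈ B) ∧ (.other ∈ A → .goal ∉ B) ∧
    (.probe ∈ A → (.high0 ∈ A ∧ .goal ∈ A) ∨ (.low0 ∈ A ∧ .scan0 ∈ A)) ∧
    (.high0 ∈ A → .high1 ∈ B) ∧ (.high1 ∈ A → .atRoot ∈ B) ∧
    (.low0 ∈ A → .low1 ∈ B) ∧ (.low1 ∈ A → .atNull ∈ B)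

end Obstruction

/-! ### The graph `P` -/

/-- The colours of the inner nodes of `P`. The colours `C0` and `C1` are those of the first two
nodes `C₀` and `C₁`, and `Ce`, `Co`, `Ue`, `Uo`, `Le`, `Lo` those of the other nodes `C₂ᵢ`,
`C₂ᵢ₊₁`, `U₂ᵢ`, `U₂ᵢ₊₁`, `L₂ᵢ`, `L₂ᵢ₊₁`. The Boolean tells whether following `s2`-edges from the
node ends in `root`. -/
inductive Colour : Type
  | C0 | C1 | Ce | Co
  | Ue (b : Bool) | Uo (b : Bool) | Le (b : Bool) | Lo (b : Bool)
  deriving Fintype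

/-- The `s1`-edges of `P`. -/
inductive ColourEdge1 : Colour → Pointed Colour → Prop
  | C0 : ColourEdge1 .C0 (.inner .C1)
  | C1 : ColourEdge1 .C1 (.inner .Ce)
  | Ce : ColourEdge1 .Ce (.inner .Co)
  | Co : ColourEdge1 .Co (.inner .Ce)
  | Co_null : ColourEdge1 .Co .null
  | Ue (a b : Bool) : ColourEdge1 (.Ue a) (.inner (.Uo b))
  | Uo (a b : Bool) : ColourEdge1 (.Uo a) (.inner (.Ue b))
  | Uo_null (a : Bool) : ColourEdge1 (.Uo a) .null
  | Le (a b : Bool) : ColourEdge1 (.Le a) (.inner (.Lo b))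
  | Lo (a b : Bool) : ColourEdge1 (.Lo a) (.inner (.Le b))
  | Lo_null (a : Bool) : ColourEdge1 (.Lo a) .null

/-- The `s2`-edges of `P`. -/
inductive ColourEdge2 : Colour → Pointed Colour → Prop
  | C0 : ColourEdge2 .C0 (.inner (.Ue true))
  | C1 : ColourEdge2 .C1 (.inner (.Lo true))
  | Ce : ColourEdge2 .Ce (.inner (.Ue true))
  | Co : ColourEdge2 .Co (.inner (.Lo true))
  | Ue (a : Bool) : ColourEdge2 (.Ue a) (.inner (.Le a))
  | Lo (a : Bool) : ColourEdge2 (.Lo a) (.inner (.Uo a))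
  | Le_root : ColourEdge2 (.Le true) .root
  | Le_null : ColourEdge2 (.Le false) .null
  | Uo_root : ColourEdge2 (.Uo true) .root
  | Uo_null : ColourEdge2 (.Uo false) .null

/-- The graph `P`. -/
def colourGraph : RootedGraph.{0} :=
  ofRules Colour (· = .C0) ColourEdge1 ColourEdge2

/-! ### Successor functions of corresponder graphs -/

/-- The `s1`-successor of a node of a corresponder graph. -/
def cNext1 {n k : ℕ} (hk : 0 < 2 * k) : CNode n k → CNode n k
  | .null => .null
  | .root => .C ⟨0, hk⟩
  | .C i => if h : (i : ℕ) + 1 < 2 * k then .C ⟨i + 1, h⟩ else .null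
  | .U i => if h : (i : ℕ) + 1 < 2 * n then .U ⟨i + 1, h⟩ else .null
  | .L i => if h : (i : ℕ) + 1 < 2 * n then .L ⟨i + 1, h⟩ else .null

open Classical in
/-- The `s2`-successor of a node of a corresponder graph. -/
noncomputable def cNext2 {n k : ℕ} (u l : Fin k → Fin n) : CNode n k → CNode n k
  | .null => .null
  | .root => .null
  | .C i =>
    if (i : ℕ) % 2 = 0 then .U ⟨2 * (u ⟨i / 2, by omega⟩ : ℕ), by omega⟩
    else .L ⟨2 * (l ⟨i / 2, by omega⟩ : ℕ) + 1, by omega⟩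
  | .U i =>
    if (i : ℕ) % 2 = 0 then .L i
    else if ∃ j, (l j : ℕ) = i / 2 then .root else .null
  | .L i =>
    if (i : ℕ) % 2 = 0 then if ∃ j, (u j : ℕ) = i / 2 then .root else .null
    else .U i

theorem cEdge1_iff {n k : ℕ} (hk : 0 < 2 * k) (x y : CNode n k) :
    CEdge1 n k x y ↔ cNext1 hk x = y := by
  constructor
  · rintro ⟨⟩ <;> simp only [cNext1]
    · rename_i h
      rw [dif_pos h]
    · rw [dif_neg (by omega)]
    · rename_i h
      rw [dif_pos h]
    · rw [dif_neg (by omega)]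
    · rename_i h
      rw [dif_pos h]
    · rw [dif_neg (by omega)]
  · rintro rfl
    rcases x with _ | _ | ⟨i, hi⟩ | ⟨i, hi⟩ | ⟨i, hi⟩ <;> simp only [cNext1]
    · exact .null
    · exact .root hk
    · split_ifs with h
      · exact .C i h
      · obtain rfl : i = 2 * k - 1 := by omega
        exact .C_last _
    · split_ifs with h
      · exact .U i h
      · obtain rfl : i = 2 * n - 1 := by omega
        exact .U_last _
    · split_ifs with h
      · exact .L i h
      · obtain rfl : i = 2 * n - 1 := by omega
        exact .L_last _

theorem cEdge2_iff {n k : ℕ} (u l : Fin k → Fin n) (x y : CNode n k) :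
    CEdge2 n k u l x y ↔ cNext2 u l x = y := by
  have e1 : ∀ i : ℕ, (2 * i + 1) / 2 = i := fun i => by omega
  have e2 : ∀ i : ℕ, 2 * i / 2 = i := fun i => by omega
  have e3 : ∀ i : ℕ, (2 * i + 1) % 2 = 1 := fun i => by omega
  have e4 : ∀ i : ℕ, 2 * i % 2 = 0 := fun i => by omega
  constructor
  · rintro ⟨⟩ <;> simp only [cNext2, e1, e2, e3, e4, if_true, one_ne_zero, if_false]
    · rename_i i h
      rw [if_neg]
      rintro ⟨j, hj⟩
      exact h j (Fin.ext hj)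
    · rename_i j
      rw [if_pos ⟨j, rfl⟩]
    · rename_i i h
      rw [if_neg]
      rintro ⟨j, hj⟩
      exact h j (Fin.ext hj)
    · rename_i j
      rw [if_pos ⟨j, rfl⟩]
  · rintro rfl
    rcases x with _ | _ | ⟨i, hi⟩ | ⟨i, hi⟩ | ⟨i, hi⟩
    · exact .null
    · exact .root
    all_goals
      obtain ⟨a, rfl | rfl⟩ : ∃ a, i = 2 * a ∨ i = 2 * a + 1 := ⟨i / 2, by omega⟩
      all_goals simp only [cNext2, e1, e2, e3, e4, if_true, one_ne_zero, if_false]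
    · exact .C_even ⟨a, by omega⟩
    · exact .C_odd ⟨a, by omega⟩
    · exact .U_even ⟨a, by omega⟩
    · split_ifs with h
      · obtain ⟨j, rfl⟩ := h
        exact .U_odd_root j
      · exact .U_odd_null ⟨a, by omega⟩ fun j hj => h ⟨j, by rw [hj]⟩
    · split_ifs with h
      · obtain ⟨j, rfl⟩ := h
        exact .L_even_root j
      · exact .L_even_null ⟨a, by omega⟩ fun j hj => h ⟨j, by rw [hj]⟩
    · exact .L_odd ⟨a, by omega⟩

theorem isHeap_corresponderGraph {n k : ℕ} (hk : 0 < k) (u l : Fin k → Fin n)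
    (hu : (u ⟨0, hk⟩ : ℕ) = 0) : (corresponderGraph n k u l).IsHeap := by
  have hk' : 0 < 2 * k := by omega
  refine ⟨fun x => ⟨cNext1 hk' x, (cEdge1_iff hk' x _).2 rfl,
    fun y hy => ((cEdge1_iff hk' x y).1 hy).symm⟩,
    fun x => ⟨cNext2 u l x, (cEdge2_iff u l x _).2 rfl,
    fun y hy => ((cEdge2_iff u l x y).1 hy).symm⟩, ?_⟩
  let r : CNode n k → CNode n k → Prop := fun a b => CEdge1 n k a b ∨ CEdge2 n k u l a b
  have hC : ∀ i (hi : i < 2 * k), Relation.ReflTransGen r .root (.C ⟨i, hi⟩) := by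
    intro i
    induction i with
    | zero => exact fun hi => .single (Or.inl (.root hk'))
    | succ i ih => exact fun hi => (ih (by omega)).tail (Or.inl (.C i hi))
  have hU : ∀ i (hi : i < 2 * n), Relation.ReflTransGen r .root (.U ⟨i, hi⟩) := by
    intro i
    induction i with
    | zero =>
      intro hi
      have := CEdge2.C_even (u := u) (l := l) ⟨0, hk⟩
      simp only [hu, mul_zero] at this
      exact (hC 0 hk').tail (Or.inr this)
    | succ i ih => exact fun hi => (ih (by omega)).tail (Or.inl (.U i hi))
  have hL : ∀ i (hi : i < 2 * n), Relation.ReflTransGen r .root (.L ⟨i, hi⟩) := by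
    intro i
    induction i with
    | zero => exact fun hi => (hU 0 hi).tail (Or.inr (.U_even ⟨0, by omega⟩))
    | succ i ih => exact fun hi => (ih (by omega)).tail (Or.inl (.L i hi))
  rintro (_ | _ | ⟨i, hi⟩ | ⟨i, hi⟩ | ⟨i, hi⟩) hx
  · exact absurd rfl hx
  · exact .refl
  · exact hC i hi
  · exact hU i hi
  · exact hL i hi

/-! ### Corresponder graphs map to `P` -/

open Classical in
/-- The homomorphism from a corresponder graph to `P`. -/
noncomputable def cColour {n k : ℕ} (u l : Fin k → Fin n) : CNode n k → Pointed Colour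
  | .null => .null
  | .root => .root
  | .C i => .inner <|
    if (i : ℕ) = 0 then .C0 else if (i : ℕ) = 1 then .C1
    else if (i : ℕ) % 2 = 0 then .Ce else .Co
  | .U i => .inner <|
    if (i : ℕ) % 2 = 0 then .Ue (decide (∃ j, (u j : ℕ) = i / 2))
    else .Uo (decide (∃ j, (l j : ℕ) = i / 2))
  | .L i => .inner <|
    if (i : ℕ) % 2 = 0 then .Le (decide (∃ j, (u j : ℕ) = i / 2))
    else .Lo (decide (∃ j, (l j : ℕ) = i / 2))

theorem corresponderGraph_mapsTo_colourGraph {n k : ℕ} (hk : 2 ≤ k) (u l : Fin k → Fin n) :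
    (corresponderGraph n k u l).MapsTo colourGraph := by
  have e1 : ∀ i : ℕ, (2 * i + 1) / 2 = i := fun i => by omega
  have e2 : ∀ i : ℕ, 2 * i / 2 = i := fun i => by omega
  have e3 : ∀ i : ℕ, (2 * i + 1) % 2 = 1 := fun i => by omega
  have e4 : ∀ i : ℕ, 2 * i % 2 = 0 := fun i => by omega
  have e5 : ∀ i : ℕ, 2 * i ≠ 1 := fun i => by omega
  have hi : ∀ i : ℕ, i % 2 = 0 ∧ (i + 1) % 2 = 1 ∨ i % 2 = 1 ∧ (i + 1) % 2 = 0 := by omega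
  refine ⟨cColour u l, ?_, ?_, ?_, ?_⟩
  · rintro x y (_ | _ | ⟨i, h⟩ | h | ⟨i, h⟩ | h | ⟨i, h⟩ | h)
    · rfl
    · exact ⟨_, rfl, by simp [cColour]⟩
    · show ColourEdge1 _ (cColour u l _)
      rcases i with _ | _ | i
      · simpa [cColour] using ColourEdge1.C0
      · simpa [cColour] using ColourEdge1.C1
      · rcases hi (i + 1 + 1) with ⟨h1, h2⟩ | ⟨h1, h2⟩
        · simpa [cColour, h1, h2] using ColourEdge1.Ce
        · simpa [cColour, h1, h2] using ColourEdge1.Co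
    · show ColourEdge1 _ (cColour u l _)
      simp only [cColour, show 2 * k - 1 ≠ 0 by omega, show 2 * k - 1 ≠ 1 by omega,
        show (2 * k - 1) % 2 ≠ 0 by omega, if_false]
      exact .Co_null
    · show ColourEdge1 _ (cColour u l _)
      rcases hi i with ⟨h1, h2⟩ | ⟨h1, h2⟩
      · simpa [cColour, h1, h2] using ColourEdge1.Ue _ _
      · simpa [cColour, h1, h2] using ColourEdge1.Uo _ _
    · show ColourEdge1 _ (cColour u l _)
      simp only [cColour, show (2 * n - 1) % 2 ≠ 0 by omega, if_false]
      exact .Uo_null _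
    · show ColourEdge1 _ (cColour u l _)
      rcases hi i with ⟨h1, h2⟩ | ⟨h1, h2⟩
      · simpa [cColour, h1, h2] using ColourEdge1.Le _ _
      · simpa [cColour, h1, h2] using ColourEdge1.Lo _ _
    · show ColourEdge1 _ (cColour u l _)
      simp only [cColour, show (2 * n - 1) % 2 ≠ 0 by omega, if_false]
      exact .Lo_null _
  · rintro x y (_ | _ | i | i | i | i | ⟨i, h⟩ | j | ⟨i, h⟩ | j)
    · rfl
    · rfl
    · show ColourEdge2 _ (cColour u l _)
      simp only [cColour, e4, e2, e5, if_true, if_false]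
      rw [decide_eq_true (⟨i, rfl⟩ : ∃ j, (u j : ℕ) = u i)]
      split_ifs
      · exact .C0
      · exact .Ce
    · show ColourEdge2 _ (cColour u l _)
      simp only [cColour, e3, e1, one_ne_zero, if_false]
      rw [decide_eq_true (⟨i, rfl⟩ : ∃ j, (l j : ℕ) = l i)]
      simp only [Nat.add_eq_zero_iff, one_ne_zero, and_false, if_false]
      split_ifs
      · exact .C1
      · exact .Co
    · show ColourEdge2 _ (cColour u l _)
      simp only [cColour, e4, if_true]
      exact .Ue _
    · show ColourEdge2 _ (cColour u l _)
      simp only [cColour, e3, one_ne_zero, if_false]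
      exact .Lo _
    · show ColourEdge2 _ (cColour u l _)
      simp only [cColour, e3, e1, one_ne_zero, if_false]
      rw [decide_eq_false (fun ⟨j, hj⟩ => h j (Fin.ext hj))]
      exact .Uo_null
    · show ColourEdge2 _ (cColour u l _)
      simp only [cColour, e3, e1, one_ne_zero, if_false]
      rw [decide_eq_true (⟨j, rfl⟩ : ∃ j', (l j' : ℕ) = l j)]
      exact .Uo_root
    · show ColourEdge2 _ (cColour u l _)
      simp only [cColour, e4, e2, if_true]
      rw [decide_eq_false (fun ⟨j, hj⟩ => h j (Fin.ext hj))]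
      exact .Le_null
    · show ColourEdge2 _ (cColour u l _)
      simp only [cColour, e4, e2, if_true]
      rw [decide_eq_true (⟨j, rfl⟩ : ∃ j', (u j' : ℕ) = u j)]
      exact .Le_root
  · rintro (_ | _ | i | i | i) <;> simp [cColour, corresponderGraph, colourGraph, ofRules]
  · rintro (_ | _ | i | i | i) <;> simp [cColour, corresponderGraph, colourGraph, ofRules]

/-! ### Corresponder graphs do not satisfy the obstructions -/

namespace Obstruction

/-- A marking of a corresponder graph, written as sequences: `cC i`, `cU i`, `cL i` are the marks
of `Cᵢ`, `Uᵢ`, `Lᵢ`, and the sequences end with the marks of `null`. -/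
structure IsSeqMarking (R : Obstruction) {n k : ℕ} (u l : Fin k → Fin n)
    (cC cU cL : ℕ → Set Mark) : Prop where
  C_end : cC (2 * k) = R.nullMarks
  U_end : cU (2 * n) = R.nullMarks
  L_end : cL (2 * n) = R.nullMarks
  start : R.start (cC 0)
  C1 : ∀ i < 2 * k, R.rule1 (cC i) (cC (i + 1))
  U1 : ∀ i < 2 * n, R.rule1 (cU i) (cU (i + 1))
  L1 : ∀ i < 2 * n, R.rule1 (cL i) (cL (i + 1))
  C_even : ∀ i : Fin k, R.rule2 (cC (2 * i)) (cU (2 * u i))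
  C_odd : ∀ i : Fin k, R.rule2 (cC (2 * i + 1)) (cL (2 * l i + 1))
  U_even : ∀ i < n, R.rule2 (cU (2 * i)) (cL (2 * i))
  L_odd : ∀ i < n, R.rule2 (cL (2 * i + 1)) (cU (2 * i + 1))
  U_odd_null : ∀ i : Fin n, (∀ j, l j ≠ i) → R.rule2 (cU (2 * i + 1)) R.nullMarks
  U_odd_root : ∀ j, R.rule2 (cU (2 * l j + 1)) {.atRoot}
  L_even_null : ∀ i : Fin n, (∀ j, u j ≠ i) → R.rule2 (cL (2 * i)) R.nullMarks
  L_even_root : ∀ j, R.rule2 (cL (2 * u j)) {.atRoot}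

theorem exists_isSeqMarking {R : Obstruction} {n k : ℕ} (hk : 0 < k) {u l : Fin k → Fin n}
    (h : (corresponderGraph n k u l).MapsTo R.graph) :
    ∃ cC cU cL, R.IsSeqMarking u l cC cU cL := by
  obtain ⟨c, hc⟩ := exists_isMarking_of_mapsTo h
  have c1 : ∀ x y : CNode n k, x ≠ .null → x ≠ .root → CEdge1 n k x y → R.rule1 (c x) (c y) :=
    hc.rule1
  have c2 : ∀ x y : CNode n k, x ≠ .null → x ≠ .root → CEdge2 n k u l x y →
    R.rule2 (c x) (c y) := hc.rule2
  have cn : c (.null : CNode n k) = R.nullMarks := hc.null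
  have cr : c (.root : CNode n k) = {.atRoot} := hc.root
  refine ⟨fun i => if h : i < 2 * k then c (.C ⟨i, h⟩ : CNode n k) else c (.null : CNode n k),
    fun i => if h : i < 2 * n then c (.U ⟨i, h⟩ : CNode n k) else c (.null : CNode n k),
    fun i => if h : i < 2 * n then c (.L ⟨i, h⟩ : CNode n k) else c (.null : CNode n k),
    ?_, ?_, ?_, ?_, ?_, ?_, ?_, ?_, ?_, ?_, ?_, ?_, ?_, ?_, ?_⟩
  · simpa using cn
  · simpa using cn
  · simpa using cn
  · rw [dif_pos (by omega)]
    exact hc.start _ (CEdge1.root (by omega))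
  · intro i hi
    rw [dif_pos hi]
    split_ifs with h
    · exact c1 _ _ (by simp) (by simp) (.C i h)
    · obtain rfl : i = 2 * k - 1 := by omega
      exact c1 _ _ (by simp) (by simp) (.C_last hi)
  · intro i hi
    rw [dif_pos hi]
    split_ifs with h
    · exact c1 _ _ (by simp) (by simp) (.U i h)
    · obtain rfl : i = 2 * n - 1 := by omega
      exact c1 _ _ (by simp) (by simp) (.U_last hi)
  · intro i hi
    rw [dif_pos hi]
    split_ifs with h
    · exact c1 _ _ (by simp) (by simp) (.L i h)
    · obtain rfl : i = 2 * n - 1 := by omega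
      exact c1 _ _ (by simp) (by simp) (.L_last hi)
  · intro i
    rw [dif_pos (by omega), dif_pos (by omega)]
    exact c2 _ _ (by simp) (by simp) (.C_even i)
  · intro i
    rw [dif_pos (by omega), dif_pos (by omega)]
    exact c2 _ _ (by simp) (by simp) (.C_odd i)
  · intro i hi
    rw [dif_pos (by omega), dif_pos (by omega)]
    exact c2 _ _ (by simp) (by simp) (.U_even ⟨i, hi⟩)
  · intro i hi
    rw [dif_pos (by omega), dif_pos (by omega)]
    exact c2 _ _ (by simp) (by simp) (.L_odd ⟨i, hi⟩)
  · intro i hi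
    rw [dif_pos (by omega), ← cn]
    exact c2 _ _ (by simp) (by simp) (.U_odd_null i hi)
  · intro j
    rw [dif_pos (by omega), ← cr]
    exact c2 _ _ (by simp) (by simp) (.U_odd_root j)
  · intro i hi
    rw [dif_pos (by omega), ← cn]
    exact c2 _ _ (by simp) (by simp) (.L_even_null i hi)
  · intro j
    rw [dif_pos (by omega), ← cr]
    exact c2 _ _ (by simp) (by simp) (.L_even_root j)

variable {n k : ℕ} {u l : Fin k → Fin n} {cC cU cL : ℕ → Set Mark}

theorem not_isSeqMarking_unendingC : ¬ unendingC.IsSeqMarking u l cC cU cL := by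
  intro h
  have : ∀ i ≤ 2 * k, Mark.chain0 ∈ cC i := by
    intro i
    induction i with
    | zero => exact fun _ => h.start
    | succ i ih => exact fun hi => h.C1 i (by omega) (ih (by omega))
  have := this _ le_rfl
  rw [h.C_end] at this
  exact this

theorem not_isSeqMarking_unendingU (hk : 0 < k) (hu : (u ⟨0, hk⟩ : ℕ) = 0) :
    ¬ unendingU.IsSeqMarking u l cC cU cL := by
  intro h
  have : ∀ i ≤ 2 * n, Mark.chain0 ∈ cU i := by
    intro i
    induction i with
    | zero =>
      have := h.C_even ⟨0, hk⟩ h.start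
      rw [hu] at this
      exact fun _ => this
    | succ i ih => exact fun hi => h.U1 i (by omega) (ih (by omega))
  have := this _ le_rfl
  rw [h.U_end] at this
  exact this

theorem not_isSeqMarking_badBase (hk : 0 < k) (hn : 0 < n) (hu : (u ⟨0, hk⟩ : ℕ) = 0)
    (hl : (l ⟨0, hk⟩ : ℕ) = 0) : ¬ badBase.IsSeqMarking u l cC cU cL := by
  intro h
  have h0 := (h.C_even ⟨0, hk⟩).1 h.start
  have h1 := (h.C_odd ⟨0, hk⟩).2.2 ((h.C1 0 (by omega)).1 h.start)
  rw [hu] at h0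
  rw [hl] at h1
  exact h1 ((h.L1 0 (by omega)).2 ((h.U_even 0 hn).2.1 h0))

/-- A marked chain reaches its `pick` if the end of the chain carries no mark of the chain. -/
theorem exists_pick {A B : ℕ → Set Mark} {m : ℕ}
    (h0 : .chain0 ∈ A 0 ∨ .pick ∈ A 0)
    (hA : ∀ j < m, .chain0 ∈ A j → .chain1 ∈ B j)
    (hB : ∀ j < m, .chain1 ∈ B j → .chain0 ∈ A (j + 1) ∨ .pick ∈ A (j + 1))
    (hm : .chain0 ∉ A m) (hm' : .pick ∉ A m) : ∃ j < m, .pick ∈ A j := by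
  by_contra hne
  push Not at hne
  have : ∀ j ≤ m, Mark.chain0 ∈ A j := by
    intro j
    induction j with
    | zero =>
      intro _
      rcases h0 with h0 | h0
      · exact h0
      · rcases Nat.eq_zero_or_pos m with rfl | hpos
        · exact absurd h0 hm'
        · exact absurd h0 (hne 0 hpos)
    | succ j ih =>
      intro hj
      rcases hB j (by omega) (hA j (by omega) (ih (by omega))) with h | h
      · exact h
      · rcases Nat.lt_or_ge (j + 1) m with hlt | hge
        · exact absurd h (hne _ hlt)
        · obtain rfl : j + 1 = m := by omega
          exact absurd h hm'
  exact hm (this m le_rfl)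

theorem not_isSeqMarking_badOdd (hk : 0 < k) (hu : (u ⟨0, hk⟩ : ℕ) = 0) :
    ¬ badOdd.IsSeqMarking u l cC cU cL := by
  intro h
  have h0 := (h.C_even ⟨0, hk⟩).1 h.start
  rw [hu] at h0
  obtain ⟨j, hj, hp⟩ := exists_pick (A := fun j => cU (2 * j)) (B := fun j => cU (2 * j + 1))
    (m := n) h0 (fun j hj => (h.U1 (2 * j) (by omega)).1)
    (fun j hj => (h.U1 (2 * j + 1) (by omega)).2.1)
    (by rw [h.U_end]; exact id) (by rw [h.U_end]; exact id)
  have h1 := (h.U1 (2 * j) (by omega)).2.2.1 hp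
  have h2 := (h.L1 (2 * j) (by omega)).2.2.2 ((h.U_even j hj).2.1 hp)
  exact (h.L_odd j hj).2.2 h2 h1

theorem not_isSeqMarking_badEven (β : Bool) (hk : 0 < k) (hu : (u ⟨0, hk⟩ : ℕ) = 0) :
    ¬ (badEven β).IsSeqMarking u l cC cU cL := by
  intro h
  have h0 := (h.C_even ⟨0, hk⟩).1 h.start
  rw [hu] at h0
  obtain ⟨j, hj, hp⟩ := exists_pick (A := fun j => cU (2 * j)) (B := fun j => cU (2 * j + 1))
    (m := n) h0 (fun j hj => (h.U1 (2 * j) (by omega)).1)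
    (fun j hj => (h.U1 (2 * j + 1) (by omega)).2.1)
    (by rw [h.U_end]; cases β <;> simp [badEven])
    (by rw [h.U_end]; cases β <;> simp [badEven])
  have h1 := (h.U1 (2 * j + 1) (by omega)).2.2.2.1 ((h.U1 (2 * j) (by omega)).2.2.1 hp)
  have h2 := (h.L1 (2 * j + 1) (by omega)).2.2.2.2.2
    ((h.L1 (2 * j) (by omega)).2.2.2.2.1 ((h.U_even j hj).2.1 hp))
  rcases Nat.lt_or_ge (j + 1) n with hlt | hge
  · exact (h.U_even (j + 1) hlt).2.2 h1 h2
  · have e : 2 * j + 1 + 1 = 2 * n := by omega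
    rw [e, h.U_end] at h1
    rw [e, h.L_end] at h2
    cases β <;> simp_all [badEven]

/-- The contradiction behind `badNext`, for sequences `DA`, `WA` of marks of the considered nodes
`Dⱼ` and of the scanned nodes, sequences `DB`, `WB` of marks of their `s1`-successors, and the
sequence `XA` of marks of the `s2`-successors of the scanned nodes. -/
theorem badNext_false {σ β : Bool} {v : Fin k → Fin n} (hv : StrictMono v)
    {DA DB WA WB XA : ℕ → Set Mark}
    (h0 : .chain0 ∈ DA 0 ∨ .pick ∈ DA 0)
    (hD : ∀ j < k, (badNext σ β).rule1 (DA j) (DB j))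
    (hD' : ∀ j < k, (badNext σ β).rule1 (DB j) (DA (j + 1)))
    (hDk : DA k = (badNext σ β).nullMarks)
    (hW : ∀ t < n, (badNext σ β).rule1 (WA t) (WB t))
    (hW' : ∀ t < n, (badNext σ β).rule1 (WB t) (WA (t + 1)))
    (hWn : WA n = (badNext σ β).nullMarks)
    (hDW : ∀ j : Fin k, (badNext σ β).rule2 (DA j) (WA (v j)))
    (hWX : ∀ t < n, (badNext σ β).rule2 (WA t) (XA t))
    (hroot : ∀ j, (badNext σ β).rule2 (XA (v j)) {.atRoot})
    (hnull : ∀ t : Fin n, (∀ j, v j ≠ t) → (badNext σ β).rule2 (XA t) (badNext σ β).nullMarks) :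
    False := by
  obtain ⟨i, hi, hp⟩ := exists_pick h0 (fun j hj => (hD j hj).1) (fun j hj => (hD' j hj).2.1)
    (by rw [hDk]; cases β <;> simp [badNext]) (by rw [hDk]; cases β <;> simp [badNext])
  have hscan := (hDW ⟨i, hi⟩).1 hp
  have hother := (hD' i hi).2.2.2.1 ((hD i hi).2.2.1 hp)
  have hnull_root : Mark.atRoot ∉ (badNext σ β).nullMarks := by cases β <;> simp [badNext]
  -- the scan goes on up to the next high node, or to the end of the chain
  have walk : ∀ T ≤ n, (∀ t, (v ⟨i, hi⟩ : ℕ) < t → t < T → ∀ j, (v j : ℕ) ≠ t) →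
      (v ⟨i, hi⟩ : ℕ) < T → Mark.probe ∈ WA T := by
    intro T hT hgap hlt
    have : ∀ d, (v ⟨i, hi⟩ : ℕ) + d < T → Mark.scan0 ∈ WA (v ⟨i, hi⟩ + d) := by
      intro d
      induction d with
      | zero => exact fun _ => hscan
      | succ d ih =>
        intro hd
        have hs := ih (by omega)
        have hprobe := (hW' _ (by omega)).2.2.2.2.2 ((hW _ (by omega)).2.2.2.2.1 hs)
        rcases (hWX (v ⟨i, hi⟩ + d + 1) (by omega)).2.2.1 hprobe with ⟨h1, -⟩ | ⟨-, h2⟩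
        · have h3 := (hWX (v ⟨i, hi⟩ + d + 1) (by omega)).2.2.2.1 h1
          have h4 := (hnull ⟨v ⟨i, hi⟩ + d + 1, by omega⟩ (fun j hj =>
            hgap (v ⟨i, hi⟩ + d + 1) (by omega) (by omega) j (congrArg Fin.val hj))).2.2.2.2.1 h3
          exact absurd h4 hnull_root
        · exact h2
    have hs := this (T - 1 - v ⟨i, hi⟩) (by omega)
    rw [show (v ⟨i, hi⟩ : ℕ) + (T - 1 - v ⟨i, hi⟩) = T - 1 by omega] at hs
    have := (hW' (T - 1) (by omega)).2.2.2.2.2 ((hW (T - 1) (by omega)).2.2.2.2.1 hs)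
    rwa [show T - 1 + 1 = T by omega] at this
  rcases Nat.lt_or_ge (i + 1) k with hlt | hge
  · have hprobe := walk (v ⟨i + 1, hlt⟩) (by omega) (by
      intro t h1 h2 j hj
      have h1' : v ⟨i, hi⟩ < v j := by rw [Fin.lt_def]; omega
      have h2' : v j < v ⟨i + 1, hlt⟩ := by rw [Fin.lt_def]; omega
      rw [hv.lt_iff_lt, Fin.lt_def] at h1' h2'
      simp only at h1' h2'
      omega) (hv (by simp [Fin.lt_def]))
    have hX := hWX (v ⟨i + 1, hlt⟩) (by omega)
    rcases hX.2.2.1 hprobe with ⟨-, h2⟩ | ⟨h1, -⟩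
    · exact (hDW ⟨i + 1, hlt⟩).2.1 hother h2
    · have := (hroot ⟨i + 1, hlt⟩).2.2.2.2.2.2 (hX.2.2.2.2.2.1 h1)
      simp at this
  · have hprobe := walk n le_rfl (by
      intro t h1 h2 j hj
      have h1' : v ⟨i, hi⟩ < v j := by rw [Fin.lt_def]; omega
      rw [hv.lt_iff_lt, Fin.lt_def] at h1'
      simp only at h1'
      omega) (v ⟨i, hi⟩).2
    obtain rfl : i + 1 = k := by omega
    rw [hDk] at hother
    rw [hWn] at hprobe
    cases β <;> simp_all [badNext]

theorem badNext_rule1_null (σ β : Bool) :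
    (badNext σ β).rule1 (badNext σ β).nullMarks (badNext σ β).nullMarks := by
  cases β <;> simp [badNext]

theorem not_isSeqMarking_badNext_true (β : Bool) (hu : StrictMono u) :
    ¬ (badNext true β).IsSeqMarking u l cC cU cL := by
  intro h
  exact badNext_false (DA := fun j => cC (2 * j)) (DB := fun j => cC (2 * j + 1))
    (WA := fun j => cU (2 * j)) (WB := fun j => cU (2 * j + 1)) (XA := fun j => cL (2 * j)) hu
    (by simpa [badNext] using h.start)
    (fun j hj => h.C1 _ (by omega)) (fun j hj => h.C1 _ (by omega)) h.C_end
    (fun j hj => h.U1 _ (by omega)) (fun j hj => h.U1 _ (by omega)) h.U_end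
    h.C_even h.U_even h.L_even_root h.L_even_null

theorem not_isSeqMarking_badNext_false (β : Bool) (hk : 0 < k) (hl : StrictMono l) :
    ¬ (badNext false β).IsSeqMarking u l cC cU cL := by
  intro h
  -- the sequences are extended by `null` beyond the last node
  let ext (c : ℕ → Set Mark) (m i : ℕ) := if i ≤ m then c i else (badNext false β).nullMarks
  have hext : ∀ (c : ℕ → Set Mark) (m : ℕ), c m = (badNext false β).nullMarks →
      (∀ i < m, (badNext false β).rule1 (c i) (c (i + 1))) →
      ∀ i, i ≤ m → (badNext false β).rule1 (ext c m i) (ext c m (i + 1)) := by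
    intro c m hm hc i hi
    rcases Nat.lt_or_ge i m with hlt | hge
    · simp only [ext, if_pos hi, if_pos (Nat.succ_le_of_lt hlt)]
      exact hc i hlt
    · obtain rfl : i = m := by omega
      simp only [ext, le_refl, if_true, hm, show ¬ i + 1 ≤ i by omega, if_false]
      exact badNext_rule1_null _ _
  have hin : ∀ (c : ℕ → Set Mark) (m i : ℕ), i ≤ m → ext c m i = c i := by
    intro c m i hi
    simp [ext, hi]
  refine badNext_false (σ := false) (β := β) (DA := fun j => ext cC (2 * k) (2 * j + 1))
    (DB := fun j => ext cC (2 * k) (2 * j + 1 + 1))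
    (WA := fun j => ext cL (2 * n) (2 * j + 1)) (WB := fun j => ext cL (2 * n) (2 * j + 1 + 1))
    (XA := fun j => cU (2 * j + 1)) hl ?_
    (fun j hj => hext _ _ h.C_end h.C1 _ (by omega))
    (fun j hj => hext _ _ h.C_end h.C1 _ (by omega)) (by simp [ext])
    (fun j hj => hext _ _ h.L_end h.L1 _ (by omega))
    (fun j hj => hext _ _ h.L_end h.L1 _ (by omega)) (by simp [ext])
    (fun j => ?_) (fun t ht => ?_) h.U_odd_root h.U_odd_null
  · have h1 : Mark.chain1 ∈ cC 0 := by simpa [badNext] using h.start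
    simp only [ext, show 2 * 0 + 1 ≤ 2 * k by omega, if_true]
    exact (h.C1 0 (by omega)).2.1 h1
  · simp only [hin _ _ _ (show 2 * (j : ℕ) + 1 ≤ 2 * k by omega),
      hin _ _ _ (show 2 * (l j : ℕ) + 1 ≤ 2 * n by omega)]
    exact h.C_odd j
  · simp only [hin _ _ _ (show 2 * t + 1 ≤ 2 * n by omega)]
    exact h.L_odd t ht

end Obstruction

/-! ### Heaps that map to `P` -/

/-- The six sorts of inner nodes: `C`, `U`, `L` with even and odd index. -/
inductive NodeSort : Type
  | Ce | Co | Ue | Uo | Le | Lo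

/-- The sort of the nodes of a given colour. -/
def Colour.sort : Colour → NodeSort
  | .C0 => .Ce
  | .C1 => .Co
  | .Ce => .Ce
  | .Co => .Co
  | .Ue _ => .Ue
  | .Uo _ => .Uo
  | .Le _ => .Le
  | .Lo _ => .Lo

/-- What a homomorphism to `P` says about the successor functions `f` and `g` of a heap: `S a x`
expresses that the inner node `x` is of sort `a`. -/
structure IsLayered (G : RootedGraph.{u}) (f g : G.V → G.V) (S : NodeSort → G.V → Prop) : Prop
    extends IsFunctional G f g where
  ne_null : ∀ {a x}, S a x → x ≠ G.null
  ne_root : ∀ {a x}, S a x → x ≠ G.root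
  unique : ∀ {a b x}, S a x → S b x → a = b
  sort_C0 : S .Ce (f G.root)
  sort_C2 : S .Ce (f (f (f G.root)))
  f_Ce : ∀ x, S .Ce x → S .Co (f x)
  f_Co : ∀ x, S .Co x → f x = G.null ∨ S .Ce (f x)
  f_Ue : ∀ x, S .Ue x → S .Uo (f x)
  f_Uo : ∀ x, S .Uo x → f x = G.null ∨ S .Ue (f x)
  f_Le : ∀ x, S .Le x → S .Lo (f x)
  f_Lo : ∀ x, S .Lo x → f x = G.null ∨ S .Le (f x)
  g_Ce : ∀ x, S .Ce x → S .Ue (g x)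
  g_Co : ∀ x, S .Co x → S .Lo (g x)
  g_Ue : ∀ x, S .Ue x → S .Le (g x)
  g_Lo : ∀ x, S .Lo x → S .Uo (g x)
  g_Le : ∀ x, S .Le x → g x = G.root ∨ g x = G.null
  g_Uo : ∀ x, S .Uo x → g x = G.root ∨ g x = G.null
  ggg_Ce : ∀ x, S .Ce x → g (g (g x)) = G.root
  ggg_Co : ∀ x, S .Co x → g (g (g x)) = G.root

theorem IsFunctional.f_null {G : RootedGraph.{u}} {f g : G.V → G.V} (h : G.IsFunctional f g) :
    f G.null = G.null :=
  (h.s1_iff _ _).1 ((G.s1_null _).2 rfl)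

theorem IsFunctional.g_null {G : RootedGraph.{u}} {f g : G.V → G.V} (h : G.IsFunctional f g) :
    g G.null = G.null :=
  (h.s2_iff _ _).1 ((G.s2_null _).2 rfl)

theorem exists_isLayered {G : RootedGraph.{u}} (hG : G.IsHeap) (h : G.MapsTo colourGraph) :
    ∃ f g S, G.IsLayered f g S := by
  obtain ⟨h, hh⟩ := h
  choose f hf using fun x => (hG.s1_function x).exists
  choose g hg using fun x => (hG.s2_function x).exists
  have hroot : ∀ x, h x = .root ↔ x = G.root := hh.map_root_iff
  have hnull : ∀ x, h x = .null ↔ x = G.null := hh.map_null_iff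
  have e1 : ∀ x c, h x = .inner c → ColourEdge1 c (h (f x)) := by
    intro x c hx
    have := hh.map_s1 _ _ (hf x)
    rwa [hx] at this
  have e2 : ∀ x c, h x = .inner c → ColourEdge2 c (h (g x)) := by
    intro x c hx
    have := hh.map_s2 _ _ (hg x)
    rwa [hx] at this
  have s0 : h (f G.root) = .inner .C0 := by
    have := hh.map_s1 _ _ (hf G.root)
    rw [(hroot _).2 rfl] at this
    obtain ⟨t, rfl, ht⟩ := this
    exact ht
  have s1 : h (f (f G.root)) = .inner .C1 := by
    have := e1 _ _ s0
    generalize h (f (f G.root)) = y at this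
    cases this
    rfl
  have s2 : h (f (f (f G.root))) = .inner .Ce := by
    have := e1 _ _ s1
    generalize h (f (f (f G.root))) = y at this
    cases this
    rfl
  refine ⟨f, g, fun a x => ∃ c : Colour, h x = .inner c ∧ c.sort = a,
    { s1_iff := fun x y => ⟨fun hxy => (hG.s1_function x).unique (hf x) hxy, fun e => e ▸ hf x⟩
      s2_iff := fun x y => ⟨fun hxy => (hG.s2_function x).unique (hg x) hxy, fun e => e ▸ hg x⟩
      g_root := ?_, f_root_ne_null := ?_, f_root_ne_root := ?_, ne_null := ?_, ne_root := ?_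
      unique := ?_, sort_C0 := ⟨_, s0, rfl⟩, sort_C2 := ⟨_, s2, rfl⟩, f_Ce := ?_, f_Co := ?_
      f_Ue := ?_, f_Uo := ?_, f_Le := ?_, f_Lo := ?_, g_Ce := ?_, g_Co := ?_, g_Ue := ?_
      g_Lo := ?_, g_Le := ?_, g_Uo := ?_, ggg_Ce := ?_, ggg_Co := ?_ }⟩
  · have := hh.map_s2 _ _ (hg G.root)
    rw [(hroot _).2 rfl] at this
    exact (hnull _).1 this
  · intro e
    rw [(hnull _).2 e] at s0
    cases s0
  · intro e
    rw [(hroot _).2 e] at s0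
    cases s0
  · rintro a x ⟨c, hc, -⟩ e
    rw [(hnull _).2 e] at hc
    cases hc
  · rintro a x ⟨c, hc, -⟩ e
    rw [(hroot _).2 e] at hc
    cases hc
  · rintro a b x ⟨c, hc, rfl⟩ ⟨c', hc', rfl⟩
    rw [hc] at hc'
    cases hc'
    rfl
  -- the rules for `f`
  iterate 6
    rintro x ⟨c, hc, hs⟩
    try simp only [← hnull]
    have := e1 _ _ hc
    generalize h (f x) = y at this
    cases this <;> cases hs <;>
      first
        | exact Or.inl rfl
        | exact Or.inr rfl
        | exact ⟨_, rfl, rfl⟩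
        | exact Or.inr ⟨_, rfl, rfl⟩
  -- the rules for `g`
  iterate 6
    rintro x ⟨c, hc, hs⟩
    try simp only [← hnull, ← hroot]
    have := e2 _ _ hc
    generalize h (g x) = y at this
    cases this <;> cases hs <;>
      first
        | exact Or.inl rfl
        | exact Or.inr rfl
        | exact ⟨_, rfl, rfl⟩
  · rintro x ⟨c, hc, hs⟩
    have h1 : h (g x) = .inner (.Ue true) := by
      have := e2 _ _ hc
      generalize h (g x) = y at this
      cases this <;> cases hs <;> rfl
    have h2 : h (g (g x)) = .inner (.Le true) := by
      have := e2 _ _ h1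
      generalize h (g (g x)) = y at this
      cases this
      rfl
    rw [← hroot]
    have := e2 _ _ h2
    generalize h (g (g (g x))) = y at this
    cases this
    rfl
  · rintro x ⟨c, hc, hs⟩
    have h1 : h (g x) = .inner (.Lo true) := by
      have := e2 _ _ hc
      generalize h (g x) = y at this
      cases this <;> cases hs <;> rfl
    have h2 : h (g (g x)) = .inner (.Uo true) := by
      have := e2 _ _ h1
      generalize h (g (g x)) = y at this
      cases this
      rfl
    rw [← hroot]
    have := e2 _ _ h2
    generalize h (g (g (g x))) = y at this
    cases this
    rfl

section Sequences

variable {G : RootedGraph.{u}} {f g : G.V → G.V} {S : NodeSort → G.V → Prop}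

/-- Along an `f`-path whose nodes alternate between the sorts `a` and `b`, the path can end in
`null` only after a node of sort `b`. -/
theorem sort_iterate (h : G.IsFunctional f g) {a b : NodeSort} (ha : ∀ x, S a x → S b (f x))
    (hb : ∀ x, S b x → f x = G.null ∨ S a (f x)) {x : G.V} (hx : S a x) (i : ℕ) :
    (f^[2 * i] x = G.null ∧ f^[2 * i + 1] x = G.null) ∨
      (S a (f^[2 * i] x) ∧ S b (f^[2 * i + 1] x)) := by
  induction i with
  | zero => exact Or.inr ⟨hx, ha x hx⟩
  | succ i ih =>
    have e : 2 * (i + 1) = 2 * i + 1 + 1 := by ring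
    rw [e, Function.iterate_succ_apply' f (2 * i + 1 + 1),
      Function.iterate_succ_apply' f (2 * i + 1)]
    rcases ih with ⟨-, h2⟩ | ⟨-, h2⟩
    · rw [h2, h.f_null]
      exact Or.inl ⟨rfl, h.f_null⟩
    · rcases hb _ h2 with h3 | h3
      · rw [h3]
        exact Or.inl ⟨rfl, h.f_null⟩
      · exact Or.inr ⟨h3, ha _ h3⟩

theorem iterate_eq_null_of_le (h : G.IsFunctional f g) {x : G.V} {i j : ℕ} (hij : i ≤ j)
    (hi : f^[i] x = G.null) : f^[j] x = G.null := by
  obtain ⟨d, rfl⟩ := Nat.exists_eq_add_of_le hij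
  rw [add_comm, Function.iterate_add_apply, hi, Function.iterate_fixed h.f_null]

end Sequences

/-! ### Heaps that satisfy an obstruction -/

section Completeness

variable {G : RootedGraph.{u}} {f g : G.V → G.V} {S : NodeSort → G.V → Prop}

/-- Membership in a valuation at a node that may be `null`. -/
theorem mem_valuation_of {N : Set Mark} {p : Mark → G.V → Prop} {x : G.V} {a : Mark}
    (h2 : x ≠ G.root) (h1 : x = G.null → a ∈ N) (h : p a x) : a ∈ valuation G N p x := by
  by_cases hx : x = G.null
  · rw [hx, valuation_null]
    exact h1 hx
  · exact (mem_valuation hx h2).2 h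

open Obstruction

theorem mapsTo_unendingC (h : G.IsFunctional f g) (hr : ∀ i, f^[i] (f G.root) ≠ G.root)
    (hn : ∀ i, f^[i] (f G.root) ≠ G.null) : G.MapsTo unendingC.graph := by
  refine mapsTo_of_valuation h _ (fun a x => a = .chain0 ∧ ∃ i, x = f^[i] (f G.root)) ?_ ?_
  · exact (mem_valuation (hn 0) (hr 0)).2 ⟨rfl, 0, rfl⟩
  · refine fun x h1 h2 => ⟨fun hx => ?_, trivial⟩
    obtain ⟨-, i, rfl⟩ := (mem_valuation h1 h2).1 hx
    rw [← Function.iterate_succ_apply' f]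
    exact (mem_valuation (hn _) (hr _)).2 ⟨rfl, _, rfl⟩

theorem mapsTo_unendingU (h : G.IsFunctional f g) (hr : ∀ i, f^[i] (g (f G.root)) ≠ G.root)
    (hn : ∀ i, f^[i] (g (f G.root)) ≠ G.null) : G.MapsTo unendingU.graph := by
  refine mapsTo_of_valuation h _ (fun a x => (a = .chain0 ∧ ∃ i, x = f^[i] (g (f G.root))) ∨
    (a = .first ∧ x = f G.root)) ?_ ?_
  · exact (mem_valuation h.f_root_ne_null h.f_root_ne_root).2 (by simp)
  · refine fun x h1 h2 => ⟨fun hx => ?_, fun hx => ?_⟩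
    · obtain ⟨i, rfl⟩ : ∃ i, x = f^[i] (g (f G.root)) := by
        simpa using (mem_valuation h1 h2).1 hx
      rw [← Function.iterate_succ_apply' f]
      exact (mem_valuation (hn _) (hr _)).2 (Or.inl ⟨rfl, _, rfl⟩)
    · obtain rfl : x = f G.root := by simpa using (mem_valuation h1 h2).1 hx
      exact (mem_valuation (hn 0) (hr 0)).2 (Or.inl ⟨rfl, 0, rfl⟩)

theorem mapsTo_badBase (h : G.IsLayered f g S)
    (hne : g (f (f G.root)) ≠ f (g (g (f G.root)))) : G.MapsTo badBase.graph := by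
  have sU := h.g_Ce _ h.sort_C0
  have sL := h.g_Ue _ sU
  have sL1 := h.f_Le _ sL
  have sC1 := h.f_Ce _ h.sort_C0
  let p : Mark → G.V → Prop := fun a x =>
    match a with
    | .first => x = f G.root
    | .other => x = f (f G.root)
    | .scan0 => x = g (f G.root)
    | .scan1 => x = g (g (f G.root))
    | .goal => x = f (g (g (f G.root)))
    | _ => False
  have hp : ∀ {a x}, x ≠ G.null → x ≠ G.root →
      (a ∈ valuation G badBase.nullMarks p x ↔ p a x) := fun h1 h2 => mem_valuation h1 h2
  have hS : ∀ {a s x}, S s x → p a x → a ∈ valuation G badBase.nullMarks p x :=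
    fun hs hx => (hp (h.ne_null hs) (h.ne_root hs)).2 hx
  refine mapsTo_of_valuation h.toIsFunctional _ p (hS h.sort_C0 rfl) ?_
  refine fun x h1 h2 => ⟨⟨fun hx => ?_, fun hx => ?_⟩, fun hx => ?_, fun hx => ?_, fun hx => ?_⟩
  · obtain rfl : x = _ := (hp h1 h2).1 hx
    exact hS sC1 rfl
  · obtain rfl : x = _ := (hp h1 h2).1 hx
    exact hS sL1 rfl
  · obtain rfl : x = _ := (hp h1 h2).1 hx
    exact hS sU rfl
  · obtain rfl : x = _ := (hp h1 h2).1 hx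
    exact hS sL rfl
  · obtain rfl : x = _ := (hp h1 h2).1 hx
    have sg := h.g_Co _ sC1
    rw [hp (h.ne_null sg) (h.ne_root sg)]
    exact hne

theorem mapsTo_badOdd (h : G.IsLayered f g S) {W : ℕ → G.V} (hW0 : W 0 = g (f G.root))
    (hW : ∀ j, W (j + 1) = f (f (W j))) {i : ℕ} (hWS : ∀ j ≤ i, S .Ue (W j))
    (hne : g (f (g (W i))) ≠ f (W i)) : G.MapsTo badOdd.graph := by
  let p : Mark → G.V → Prop := fun a x =>
    match a with
    | .first => x = f G.root
    | .chain0 => ∃ j < i, x = W j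
    | .chain1 => ∃ j < i, x = f (W j)
    | .pick => x = W i
    | .scan0 => x = g (W i)
    | .scan1 => x = f (g (W i))
    | .goal => x = f (W i)
    | _ => False
  have hp : ∀ {a x}, x ≠ G.null → x ≠ G.root →
      (a ∈ valuation G badOdd.nullMarks p x ↔ p a x) := fun h1 h2 => mem_valuation h1 h2
  have hS : ∀ {a s x}, S s x → p a x → a ∈ valuation G badOdd.nullMarks p x :=
    fun hs hx => (hp (h.ne_null hs) (h.ne_root hs)).2 hx
  have hnext : ∀ j ≤ i, .chain0 ∈ valuation G badOdd.nullMarks p (W j) ∨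
      .pick ∈ valuation G badOdd.nullMarks p (W j) := by
    intro j hj
    rcases hj.lt_or_eq with hlt | rfl
    · exact Or.inl (hS (hWS j hj) ⟨j, hlt, rfl⟩)
    · exact Or.inr (hS (hWS j hj) rfl)
  have sL := h.g_Ue _ (hWS i le_rfl)
  have sL1 := h.f_Le _ sL
  refine mapsTo_of_valuation h.toIsFunctional _ p (hS h.sort_C0 rfl) ?_
  refine fun x h1 h2 => ⟨⟨fun hx => ?_, fun hx => ?_, fun hx => ?_, fun hx => ?_⟩,
    fun hx => ?_, fun hx => ?_, fun hx => ?_⟩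
  · obtain ⟨j, hj, rfl⟩ := (hp h1 h2).1 hx
    exact hS (h.f_Ue _ (hWS j hj.le)) ⟨j, hj, rfl⟩
  · obtain ⟨j, hj, rfl⟩ := (hp h1 h2).1 hx
    rw [← hW]
    exact hnext (j + 1) hj
  · obtain rfl : x = _ := (hp h1 h2).1 hx
    exact hS (h.f_Ue _ (hWS i le_rfl)) rfl
  · obtain rfl : x = _ := (hp h1 h2).1 hx
    exact hS sL1 rfl
  · obtain rfl : x = _ := (hp h1 h2).1 hx
    rw [← hW0]
    exact hnext 0 (Nat.zero_le i)
  · obtain rfl : x = _ := (hp h1 h2).1 hx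
    exact hS sL rfl
  · obtain rfl : x = _ := (hp h1 h2).1 hx
    have sg := h.g_Lo _ sL1
    rw [hp (h.ne_null sg) (h.ne_root sg)]
    exact hne

theorem mapsTo_badEven (h : G.IsLayered f g S) {W : ℕ → G.V} (hW0 : W 0 = g (f G.root))
    (hW : ∀ j, W (j + 1) = f (f (W j))) {i : ℕ} (hWS : ∀ j ≤ i, S .Ue (W j))
    (hne : f (f (g (W i))) ≠ g (f (f (W i)))) {β : Bool}
    (hβ : β = true ↔ f (f (g (W i))) = G.null) : G.MapsTo (badEven β).graph := by
  let p : Mark → G.V → Prop := fun a x =>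
    match a with
    | .first => x = f G.root
    | .chain0 => ∃ j < i, x = W j
    | .chain1 => ∃ j < i, x = f (W j)
    | .pick => x = W i
    | .pick1 => x = f (W i)
    | .other => g x ≠ f (f (g (W i)))
    | .scan0 => x = g (W i)
    | .scan1 => x = f (g (W i))
    | .goal => x = f (f (g (W i)))
    | _ => False
  have hp : ∀ {a x}, x ≠ G.null → x ≠ G.root →
      (a ∈ valuation G (badEven β).nullMarks p x ↔ p a x) := fun h1 h2 => mem_valuation h1 h2
  have hS : ∀ {a s x}, S s x → p a x → a ∈ valuation G (badEven β).nullMarks p x :=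
    fun hs hx => (hp (h.ne_null hs) (h.ne_root hs)).2 hx
  have hnext : ∀ j ≤ i, .chain0 ∈ valuation G (badEven β).nullMarks p (W j) ∨
      .pick ∈ valuation G (badEven β).nullMarks p (W j) := by
    intro j hj
    rcases hj.lt_or_eq with hlt | rfl
    · exact Or.inl (hS (hWS j hj) ⟨j, hlt, rfl⟩)
    · exact Or.inr (hS (hWS j hj) rfl)
  have sU := h.f_Ue _ (hWS i le_rfl)
  have sL := h.g_Ue _ (hWS i le_rfl)
  have sL1 := h.f_Le _ sL
  have mgoal : Mark.goal ∈ (badEven β).nullMarks ↔ f (f (g (W i))) = G.null := by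
    rw [← hβ]
    cases β <;> simp [badEven]
  have mother : Mark.other ∈ (badEven β).nullMarks ↔ f (f (g (W i))) ≠ G.null := by
    rw [Ne, ← hβ]
    cases β <;> simp [badEven]
  refine mapsTo_of_valuation h.toIsFunctional _ p (hS h.sort_C0 rfl) ?_
  refine fun x h1 h2 => ⟨⟨fun hx => ?_, fun hx => ?_, fun hx => ?_, fun hx => ?_, fun hx => ?_,
    fun hx => ?_⟩, fun hx => ?_, fun hx => ?_, fun hx => ?_⟩
  · obtain ⟨j, hj, rfl⟩ := (hp h1 h2).1 hx
    exact hS (h.f_Ue _ (hWS j hj.le)) ⟨j, hj, rfl⟩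
  · obtain ⟨j, hj, rfl⟩ := (hp h1 h2).1 hx
    rw [← hW]
    exact hnext (j + 1) hj
  · obtain rfl : x = _ := (hp h1 h2).1 hx
    exact hS sU rfl
  · obtain rfl : x = _ := (hp h1 h2).1 hx
    rcases h.f_Uo _ sU with hn | hs
    · rw [hn, valuation_null, mother]
      rwa [hn, h.g_null] at hne
    · exact hS hs hne.symm
  · obtain rfl : x = _ := (hp h1 h2).1 hx
    exact hS sL1 rfl
  · obtain rfl : x = _ := (hp h1 h2).1 hx
    rcases h.f_Lo _ sL1 with hn | hs
    · rw [hn, valuation_null, mgoal]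
      exact hn
    · exact hS hs rfl
  · obtain rfl : x = _ := (hp h1 h2).1 hx
    rw [← hW0]
    exact hnext 0 (Nat.zero_le i)
  · obtain rfl : x = _ := (hp h1 h2).1 hx
    exact hS sL rfl
  · have hx : g x ≠ _ := (hp h1 h2).1 hx
    by_cases hn : g x = G.null
    · rw [hn, valuation_null, mgoal]
      rw [hn] at hx
      exact hx.symm
    by_cases hr : g x = G.root
    · rw [hr, valuation_root]
      simp
    rw [hp hn hr]
    exact hx

theorem mapsTo_badNext (h : G.IsFunctional f g) {σ β : Bool} {D W : ℕ → G.V}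
    (hD0 : D 0 = if σ then f G.root else f (f G.root))
    (hD : ∀ j, D (j + 1) = f (f (D j))) (hW : ∀ t, W (t + 1) = f (f (W t)))
    (hDr : ∀ j, D j ≠ G.root) (hDr' : ∀ j, f (D j) ≠ G.root)
    (hWr : ∀ t, W t ≠ G.root) (hWr' : ∀ t, f (W t) ≠ G.root)
    {i a b : ℕ} (hDn : ∀ j ≤ i, D j ≠ G.null) (hWn : ∀ t < b, W t ≠ G.null) (hab : a < b)
    (hgD : g (D i) = W a)
    (hlow : ∀ t, a < t → t < b → g (W t) ≠ G.null ∧ g (W t) ≠ G.root ∧ g (g (W t)) = G.null)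
    (hhigh : W b ≠ G.null → g (g (W b)) = G.root)
    (hβ : β = true ↔ W b = G.null) (hne : g (D (i + 1)) ≠ W b) :
    G.MapsTo (badNext σ β).graph := by
  let p : Mark → G.V → Prop := fun m x =>
    match m with
    | .chain0 => ∃ j < i, x = D j
    | .chain1 => (∃ j < i, x = f (D j)) ∨ (σ = false ∧ x = f G.root)
    | .pick => x = D i
    | .pick1 => x = f (D i)
    | .other => g x ≠ W b
    | .scan0 => ∃ t, a ≤ t ∧ t < b ∧ x = W t
    | .scan1 => ∃ t, a ≤ t ∧ t < b ∧ x = f (W t)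
    | .probe => ∃ t, a < t ∧ t ≤ b ∧ x = W t
    | .goal => x = W b
    | .high0 => g (g x) = G.root
    | .high1 => g x = G.root
    | .low0 => g x ≠ G.null ∧ g x ≠ G.root ∧ g (g x) = G.null
    | .low1 => g x = G.null
    | _ => False
  have hp : ∀ {m x}, x ≠ G.null → x ≠ G.root →
      (m ∈ valuation G (badNext σ β).nullMarks p x ↔ p m x) := fun h1 h2 => mem_valuation h1 h2
  have m_goal : Mark.goal ∈ (badNext σ β).nullMarks ↔ W b = G.null := by
    rw [← hβ]
    cases β <;> simp [badNext]
  have m_scan : W b = G.null → Mark.scan1 ∈ (badNext σ β).nullMarks := by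
    rw [← hβ]
    rintro rfl
    simp [badNext]
  have m_probe : W b = G.null → Mark.probe ∈ (badNext σ β).nullMarks := by
    rw [← hβ]
    rintro rfl
    simp [badNext]
  have m_pick : W b ≠ G.null → Mark.pick1 ∈ (badNext σ β).nullMarks := by
    rw [Ne, ← hβ]
    intro hb
    simp [badNext, hb]
  have m_other : W b ≠ G.null → Mark.other ∈ (badNext σ β).nullMarks := by
    rw [Ne, ← hβ]
    intro hb
    simp [badNext, hb]
  have m_null : Mark.atNull ∈ (badNext σ β).nullMarks := by simp [badNext]
  have hDend : D (i + 1) = G.null → W b ≠ G.null := by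
    intro e
    rw [e, h.g_null] at hne
    exact hne.symm
  have hWend : ∀ t, t < b → W (t + 1) = G.null → W b = G.null := by
    intro t ht e
    rcases Nat.lt_or_ge (t + 1) b with hlt | hge
    · exact absurd e (hWn _ hlt)
    · rwa [show b = t + 1 by omega]
  have hnext : ∀ j ≤ i, .chain0 ∈ valuation G (badNext σ β).nullMarks p (D j) ∨
      .pick ∈ valuation G (badNext σ β).nullMarks p (D j) := by
    intro j hj
    rcases hj.lt_or_eq with hlt | rfl
    · exact Or.inl ((hp (hDn j hj) (hDr j)).2 ⟨j, hlt, rfl⟩)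
    · exact Or.inr ((hp (hDn j hj) (hDr j)).2 rfl)
  refine mapsTo_of_valuation h _ p ?_ ?_
  · cases σ
    · exact (hp h.f_root_ne_null h.f_root_ne_root).2 (Or.inr ⟨rfl, rfl⟩)
    · simp only [if_true] at hD0
      rw [← hD0]
      exact hnext 0 (Nat.zero_le i)
  refine fun x h1 h2 => ⟨⟨fun hx => ?_, fun hx => ?_, fun hx => ?_, fun hx => ?_, fun hx => ?_,
    fun hx => ?_⟩, fun hx => ?_, fun hx => ?_, fun hx => ?_, fun hx => ?_, fun hx => ?_,
    fun hx => ?_, fun hx => ?_⟩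
  · obtain ⟨j, hj, rfl⟩ := (hp h1 h2).1 hx
    refine (hp (fun e => ?_) (hDr' j)).2 (Or.inl ⟨j, hj, rfl⟩)
    apply hDn (j + 1) hj
    rw [hD, e, h.f_null]
  · rcases (hp h1 h2).1 hx with ⟨j, hj, rfl⟩ | ⟨rfl, rfl⟩
    · rw [← hD]
      exact hnext (j + 1) hj
    · simp only [Bool.false_eq_true, if_false] at hD0
      rw [← hD0]
      exact hnext 0 (Nat.zero_le i)
  · obtain rfl : x = _ := (hp h1 h2).1 hx
    refine mem_valuation_of (hDr' i) (fun e => m_pick (hDend ?_)) rfl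
    rw [hD, e, h.f_null]
  · obtain rfl : x = _ := (hp h1 h2).1 hx
    rw [← hD]
    exact mem_valuation_of (hDr _) (fun e => m_other (hDend e)) hne
  · obtain ⟨t, ht, ht', rfl⟩ := (hp h1 h2).1 hx
    refine mem_valuation_of (hWr' t) (fun e => m_scan (hWend t ht' ?_)) ⟨t, ht, ht', rfl⟩
    rw [hW, e, h.f_null]
  · obtain ⟨t, ht, ht', rfl⟩ := (hp h1 h2).1 hx
    rw [← hW]
    exact mem_valuation_of (hWr _) (fun e => m_probe (hWend t ht' e)) ⟨t + 1, by omega, ht', rfl⟩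
  · obtain rfl : x = _ := (hp h1 h2).1 hx
    rw [hgD]
    exact (hp (hWn a hab) (hWr a)).2 ⟨a, le_rfl, hab, rfl⟩
  · have hx : g x ≠ W b := (hp h1 h2).1 hx
    by_cases hn : g x = G.null
    · rw [hn, valuation_null, m_goal]
      rw [hn] at hx
      exact hx.symm
    by_cases hr : g x = G.root
    · rw [hr, valuation_root]
      simp
    rw [hp hn hr]
    exact hx
  · obtain ⟨t, ht, ht', rfl⟩ := (hp h1 h2).1 hx
    simp only [hp h1 h2]
    rcases ht'.lt_or_eq with hlt | rfl
    · exact Or.inr ⟨hlow t ht hlt, t, ht.le, hlt, rfl⟩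
    · exact Or.inl ⟨hhigh h1, rfl⟩
  · have hx : g (g x) = G.root := (hp h1 h2).1 hx
    refine (hp (fun e => ?_) (fun e => ?_)).2 hx
    · rw [e, h.g_null] at hx
      exact G.root_ne_null hx.symm
    · rw [e, h.g_root] at hx
      exact G.root_ne_null hx.symm
  · have hx : g x = G.root := (hp h1 h2).1 hx
    rw [hx, valuation_root]
    rfl
  · have hx := (hp h1 h2).1 hx
    exact (hp hx.1 hx.2.1).2 hx.2.2
  · have hx : g x = G.null := (hp h1 h2).1 hx
    rw [hx, valuation_null]
    exact m_null

end Completeness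

/-! ### Recovering the corresponder graph -/

/-- If each `v (j + 1)` is the next high term of the sequence `W` after `v j`, or the end of `W` if
there is none, then `v` enumerates the high terms of `W`. -/
theorem exists_strictMono_index {V : Type*} {z : V} {v W : ℕ → V} {n k : ℕ} (M : ℕ → Prop)
    (hk : 0 < k) (hW : ∀ t, W t = z ↔ n ≤ t) (hv : ∀ j, v j = z ↔ k ≤ j) (h0 : v 0 = W 0)
    (hM0 : M 0)
    (hnext : ∀ j a b, j < k → a < b → b ≤ n → v j = W a → (∀ t, a < t → t < b → ¬ M t) →
      (b < n → M b) → v (j + 1) = W b) :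
    ∃ u : Fin k → Fin n, StrictMono u ∧ (u ⟨0, hk⟩ : ℕ) = 0 ∧ (∀ i : Fin k, v i = W (u i)) ∧
      ∀ t < n, M t ↔ ∃ j, (u j : ℕ) = t := by
  classical
  have hex : ∀ a, ∃ t, a < t ∧ (n ≤ t ∨ M t) ∧ ∀ s, a < s → s < t → ¬ (n ≤ s ∨ M s) := by
    intro a
    have he : ∃ t, a < t ∧ (n ≤ t ∨ M t) :=
      ⟨max n (a + 1), by omega, Or.inl (le_max_left _ _)⟩
    exact ⟨Nat.find he, (Nat.find_spec he).1, (Nat.find_spec he).2,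
      fun s h1 h2 h3 => Nat.find_min he h2 ⟨h1, h3⟩⟩
  choose next hlt hhalt hgap using hex
  let a : ℕ → ℕ := fun j => next^[j] 0
  have a0 : a 0 = 0 := rfl
  have asucc : ∀ j, a (j + 1) = next (a j) := fun j => Function.iterate_succ_apply' next j 0
  have alt : ∀ j, a j < a (j + 1) := fun j => asucc j ▸ hlt (a j)
  have ahalt : ∀ j, n ≤ a (j + 1) ∨ M (a (j + 1)) := fun j => asucc j ▸ hhalt (a j)
  have agap : ∀ j t, a j < t → t < a (j + 1) → ¬ (n ≤ t ∨ M t) := fun j =>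
    asucc j ▸ hgap (a j)
  have hmono : StrictMono a := strictMono_nat_of_lt_succ alt
  have hva : ∀ j ≤ k, v j = W (a j) := by
    intro j
    induction j with
    | zero => exact fun _ => h0
    | succ j ih =>
      intro hj
      have hvj := ih (by omega)
      have haj : a j < n := by
        by_contra hge
        rw [(hW _).2 (not_lt.1 hge), hv] at hvj
        omega
      refine hnext j (a j) (a (j + 1)) hj (alt j) ?_ hvj
        (fun t h1 h2 h3 => agap j t h1 h2 (Or.inr h3)) (fun h => ?_)
      · by_contra hlt
        exact agap j n haj (not_le.1 hlt) (Or.inl le_rfl)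
      · rcases ahalt j with h' | h'
        · omega
        · exact h'
  have han : ∀ j < k, a j < n := by
    intro j hj
    by_contra hge
    have := hva j hj.le
    rw [(hW _).2 (not_lt.1 hge), hv] at this
    omega
  have hak : n ≤ a k := by
    have := hva k le_rfl
    rwa [(hv k).2 le_rfl, eq_comm, hW] at this
  refine ⟨fun j => ⟨a j, han j j.2⟩, fun i j hij => hmono hij, rfl, fun i => hva i i.2.le,
    fun t ht => ⟨fun hMt => ?_, ?_⟩⟩
  · have hexj : ∃ j, t < a j := ⟨k, by omega⟩
    have hjk : Nat.find hexj ≤ k := Nat.find_min' hexj (by omega)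
    have hspec := Nat.find_spec hexj
    rcases hj : Nat.find hexj with _ | j
    · rw [hj, a0] at hspec
      omega
    · have hle : ¬ t < a j := Nat.find_min hexj (by omega)
      rw [hj] at hspec hjk
      refine ⟨⟨j, hjk⟩, ?_⟩
      by_contra hne
      exact agap j t (by simp only at hne; omega) hspec (Or.inr hMt)
  · rintro ⟨⟨j, hj⟩, rfl⟩
    rcases j with _ | j
    · exact hM0
    · rcases ahalt j with h | h
      · have := han _ hj
        omega
      · exact h

section Recover

variable {G : RootedGraph.{u}} {f g : G.V → G.V} {S : NodeSort → G.V → Prop}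

theorem iterate_ne_root (h : G.IsLayered f g S) {a b : NodeSort} (ha : ∀ x, S a x → S b (f x))
    (hb : ∀ x, S b x → f x = G.null ∨ S a (f x)) {x : G.V} (hx : S a x) (i : ℕ) :
    f^[i] x ≠ G.root := by
  have hi := sort_iterate h.toIsFunctional ha hb hx (i / 2)
  have hn := G.root_ne_null
  rcases Nat.mod_two_eq_zero_or_one i with e | e
  · rw [show 2 * (i / 2) = i by omega] at hi
    rcases hi with ⟨h1, -⟩ | ⟨h1, -⟩
    · rw [h1]
      exact hn.symm
    · exact h.ne_root h1
  · rw [show 2 * (i / 2) + 1 = i by omega] at hi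
    rcases hi with ⟨-, h1⟩ | ⟨-, h1⟩
    · rw [h1]
      exact hn.symm
    · exact h.ne_root h1

/-- A path that alternates between two sorts and ends in `null` has an even number of nodes. -/
theorem exists_even_length (h : G.IsLayered f g S) {a b : NodeSort}
    (ha : ∀ x, S a x → S b (f x)) (hb : ∀ x, S b x → f x = G.null ∨ S a (f x)) {x : G.V}
    (hx : S a x) (hex : ∃ i, f^[i] x = G.null) :
    ∃ m, ∀ i, f^[i] x = G.null ↔ 2 * m ≤ i := by
  classical
  have hspec := Nat.find_spec hex
  obtain ⟨m, hm | hm⟩ : ∃ m, Nat.find hex = 2 * m ∨ Nat.find hex = 2 * m + 1 :=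
    ⟨Nat.find hex / 2, by omega⟩
  · refine ⟨m, fun i => ⟨fun hi => ?_, fun hi => ?_⟩⟩
    · rw [← hm]
      exact Nat.find_min' hex hi
    · rw [hm] at hspec
      exact iterate_eq_null_of_le h.toIsFunctional hi hspec
  · rw [hm] at hspec
    rcases sort_iterate h.toIsFunctional ha hb hx m with ⟨h1, -⟩ | ⟨-, h1⟩
    · exact absurd h1 (Nat.find_min hex (by omega))
    · exact absurd hspec (h.ne_null h1)

theorem iterate_injective_of_length {x z : G.V} {m i j : ℕ}
    (hm : ∀ i, f^[i] x = z ↔ m ≤ i) (hi : i < m) (hj : j < m)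
    (e : f^[i] x = f^[j] x) : i = j := by
  have key : ∀ {i j : ℕ}, i < j → j < m → f^[i] x ≠ f^[j] x := by
    intro i j hij hj e
    have e' := congrArg f^[m - j] e
    rw [← Function.iterate_add_apply, ← Function.iterate_add_apply,
      show m - j + j = m by omega, (hm m).2 le_rfl, hm] at e'
    omega
  rcases lt_trichotomy i j with h | h | h
  · exact absurd e (key h hj)
  · exact h
  · exact absurd e.symm (key h hi)

/-- A layered heap whose three paths end in `null` and satisfy the equations between them is a
corresponder graph. -/
theorem isCorresponder_of_equations (hG : G.IsHeap) (h : G.IsLayered f g S) {n k : ℕ}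
    (hk : 2 ≤ k) {u l : Fin k → Fin n} {C U L : ℕ → G.V}
    (hC : ∀ i, f^[i] (f G.root) = C i) (hU : ∀ i, f^[i] (g (f G.root)) = U i)
    (hL : ∀ i, f^[i] (g (g (f G.root))) = L i)
    (nC : ∀ i, C i = G.null ↔ 2 * k ≤ i) (nU : ∀ i, U i = G.null ↔ 2 * n ≤ i)
    (nL : ∀ i, L i = G.null ↔ 2 * n ≤ i)
    (gU : ∀ i, g (U (2 * i)) = L (2 * i)) (gL : ∀ i, g (L (2 * i + 1)) = U (2 * i + 1))
    (u0 : (u ⟨0, by omega⟩ : ℕ) = 0) (hu : StrictMono u)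
    (l0 : (l ⟨0, by omega⟩ : ℕ) = 0) (hl : StrictMono l)
    (gCe : ∀ i : Fin k, g (C (2 * i)) = U (2 * u i))
    (gCo : ∀ i : Fin k, g (C (2 * i + 1)) = L (2 * l i + 1))
    (mu : ∀ t < n, g (L (2 * t)) = G.root ↔ ∃ j, (u j : ℕ) = t)
    (ml : ∀ t < n, g (U (2 * t + 1)) = G.root ↔ ∃ j, (l j : ℕ) = t) :
    G.IsCorresponder := by
  have hn : 2 ≤ n := by
    have h1 : u ⟨0, by omega⟩ < u ⟨1, by omega⟩ := hu (by simp [Fin.lt_def])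
    have h2 := (u ⟨1, by omega⟩).2
    rw [Fin.lt_def] at h1
    omega
  have hk' : 0 < 2 * k := by omega
  have fC : ∀ i, f (C i) = C (i + 1) := fun i => by
    rw [← hC, ← hC, Function.iterate_succ_apply' f]
  have fU : ∀ i, f (U i) = U (i + 1) := fun i => by
    rw [← hU, ← hU, Function.iterate_succ_apply' f]
  have fL : ∀ i, f (L i) = L (i + 1) := fun i => by
    rw [← hL, ← hL, Function.iterate_succ_apply' f]
  have sU := h.g_Ce _ h.sort_C0
  have sL := h.g_Ue _ sU
  have sort_of : ∀ {a b : NodeSort} {x : G.V} {s : ℕ → G.V} {m : ℕ}, (∀ x, S a x → S b (f x)) →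
      (∀ x, S b x → f x = G.null ∨ S a (f x)) → S a x → (∀ i, f^[i] x = s i) →
      (∀ i, s i = G.null ↔ 2 * m ≤ i) →
      ∀ i < m, S a (s (2 * i)) ∧ S b (s (2 * i + 1)) := by
    intro a b x s m ha hb hx hs hm i hi
    have := sort_iterate h.toIsFunctional ha hb hx i
    rw [hs, hs] at this
    rcases this with ⟨h1, -⟩ | h1
    · rw [hm] at h1
      omega
    · exact h1
  have sort_of' : ∀ {a b : NodeSort} {s : ℕ → G.V} {m : ℕ},
      (∀ i < m, S a (s (2 * i)) ∧ S b (s (2 * i + 1))) →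
      ∀ i < 2 * m, S a (s i) ∨ S b (s i) := by
    intro a b s m hs i hi
    have := hs (i / 2) (by omega)
    rcases Nat.mod_two_eq_zero_or_one i with e | e
    · rw [show 2 * (i / 2) = i by omega] at this
      exact Or.inl this.1
    · rw [show 2 * (i / 2) + 1 = i by omega] at this
      exact Or.inr this.2
  have sortU := sort_of h.f_Ue h.f_Uo sU hU nU
  have sortL := sort_of h.f_Le h.f_Lo sL hL nL
  have sC := sort_of' (sort_of h.f_Ce h.f_Co h.sort_C0 hC nC)
  have sU' := sort_of' sortU
  have sL' := sort_of' sortL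
  let φ : CNode n k → G.V := fun x =>
    match x with
    | .null => G.null
    | .root => G.root
    | .C i => C i
    | .U i => U i
    | .L i => L i
  have φ1 : ∀ x, f (φ x) = φ (cNext1 hk' x) := by
    rintro (_ | _ | ⟨i, hi⟩ | ⟨i, hi⟩ | ⟨i, hi⟩)
    · exact h.f_null
    · exact hC 0
    · show f (C i) = _
      simp only [cNext1]
      split_ifs with hlt
      · exact fC i
      · rw [fC]
        exact (nC _).2 (by omega)
    · show f (U i) = _
      simp only [cNext1]
      split_ifs with hlt
      · exact fU i
      · rw [fU]
        exact (nU _).2 (by omega)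
    · show f (L i) = _
      simp only [cNext1]
      split_ifs with hlt
      · exact fL i
      · rw [fL]
        exact (nL _).2 (by omega)
  have φ2 : ∀ x y, CEdge2 n k u l x y → g (φ x) = φ y := by
    rintro x y (_ | _ | i | i | i | i | ⟨i, hi⟩ | j | ⟨i, hi⟩ | j)
    · exact h.g_null
    · exact h.g_root
    · exact gCe i
    · exact gCo i
    · exact gU i
    · exact gL i
    · refine (h.g_Uo _ (sortU i i.2).2).resolve_left fun e => ?_
      obtain ⟨j, hj⟩ := (ml i i.2).1 e
      exact hi j (Fin.ext hj)
    · exact (ml _ (l j).2).2 ⟨j, rfl⟩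
    · refine (h.g_Le _ (sortL i i.2).1).resolve_left fun e => ?_
      obtain ⟨j, hj⟩ := (mu i i.2).1 e
      exact hi j (Fin.ext hj)
    · exact (mu _ (u j).2).2 ⟨j, rfl⟩
  have φ2' : ∀ x, g (φ x) = φ (cNext2 u l x) := fun x => φ2 _ _ ((cEdge2_iff u l _ _).2 rfl)
  have ne_null : ∀ {a b x}, S a x ∨ S b x → x ≠ G.null := fun hx => hx.elim h.ne_null h.ne_null
  have ne_root : ∀ {a b x}, S a x ∨ S b x → x ≠ G.root := fun hx => hx.elim h.ne_root h.ne_root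
  have ne_CU : ∀ {x y}, S .Ce x ∨ S .Co x → S .Ue y ∨ S .Uo y → x ≠ y := by
    rintro x y (hx | hx) (hy | hy) rfl <;> cases h.unique hx hy
  have ne_CL : ∀ {x y}, S .Ce x ∨ S .Co x → S .Le y ∨ S .Lo y → x ≠ y := by
    rintro x y (hx | hx) (hy | hy) rfl <;> cases h.unique hx hy
  have ne_UL : ∀ {x y}, S .Ue x ∨ S .Uo x → S .Le y ∨ S .Lo y → x ≠ y := by
    rintro x y (hx | hx) (hy | hy) rfl <;> cases h.unique hx hy
  have inj : Function.Injective φ := by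
    rintro (_ | _ | i | i | i) (_ | _ | j | j | j) e
    · rfl
    · exact absurd e.symm G.root_ne_null
    · exact absurd e.symm (ne_null (sC j j.2))
    · exact absurd e.symm (ne_null (sU' j j.2))
    · exact absurd e.symm (ne_null (sL' j j.2))
    · exact absurd e G.root_ne_null
    · rfl
    · exact absurd e.symm (ne_root (sC j j.2))
    · exact absurd e.symm (ne_root (sU' j j.2))
    · exact absurd e.symm (ne_root (sL' j j.2))
    · exact absurd e (ne_null (sC i i.2))
    · exact absurd e (ne_root (sC i i.2))
    · have e : C i = C j := e
      rw [← hC, ← hC] at e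
      rw [Fin.ext (iterate_injective_of_length (fun i => by rw [hC]; exact nC i) i.2 j.2 e)]
    · exact absurd e (ne_CU (sC i i.2) (sU' j j.2))
    · exact absurd e (ne_CL (sC i i.2) (sL' j j.2))
    · exact absurd e (ne_null (sU' i i.2))
    · exact absurd e (ne_root (sU' i i.2))
    · exact absurd e.symm (ne_CU (sC j j.2) (sU' i i.2))
    · have e : U i = U j := e
      rw [← hU, ← hU] at e
      rw [Fin.ext (iterate_injective_of_length (fun i => by rw [hU]; exact nU i) i.2 j.2 e)]
    · exact absurd e (ne_UL (sU' i i.2) (sL' j j.2))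
    · exact absurd e (ne_null (sL' i i.2))
    · exact absurd e (ne_root (sL' i i.2))
    · exact absurd e.symm (ne_CL (sC j j.2) (sL' i i.2))
    · exact absurd e.symm (ne_UL (sU' j j.2) (sL' i i.2))
    · have e : L i = L j := e
      rw [← hL, ← hL] at e
      rw [Fin.ext (iterate_injective_of_length (fun i => by rw [hL]; exact nL i) i.2 j.2 e)]
  have surj : Function.Surjective φ := by
    intro y
    by_cases hy : y = G.null
    · exact ⟨.null, hy.symm⟩
    induction hG.reachable y hy with
    | refl => exact ⟨.root, rfl⟩
    | @tail y z hry hyz ih =>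
      by_cases hy' : y = G.null
      · subst hy'
        rw [G.s1_null, G.s2_null, or_self] at hyz
        exact absurd hyz hy
      obtain ⟨x, rfl⟩ := ih hy'
      rw [h.s1_iff, h.s2_iff, φ1, φ2'] at hyz
      exact hyz.elim (fun e => ⟨_, e⟩) (fun e => ⟨_, e⟩)
  have e1 : ∀ x y : CNode n k, CEdge1 n k x y ↔ G.s1 (φ x) (φ y) := fun x y => by
    rw [h.s1_iff, cEdge1_iff hk', φ1, inj.eq_iff]
  have e2 : ∀ x y : CNode n k, CEdge2 n k u l x y ↔ G.s2 (φ x) (φ y) := fun x y => by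
    rw [h.s2_iff, cEdge2_iff, φ2', inj.eq_iff]
  exact ⟨n, k, hn, hk, u, l, u0, hu, l0, hl,
    IsIsomorphic.symm ⟨Equiv.ofBijective φ ⟨inj, surj⟩, e1, e2, rfl, rfl⟩⟩

open Obstruction in
theorem isCorresponder_of_not_mapsTo (hG : G.IsHeap) (h : G.IsLayered f g S)
    (h1 : ¬ G.MapsTo unendingC.graph) (h2 : ¬ G.MapsTo unendingU.graph)
    (h3 : ¬ G.MapsTo badBase.graph) (h4 : ¬ G.MapsTo badOdd.graph)
    (h5 : ∀ β, ¬ G.MapsTo (badEven β).graph) (h6 : ∀ σ β, ¬ G.MapsTo (badNext σ β).graph) :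
    G.IsCorresponder := by
  classical
  have hF := h.toIsFunctional
  have sU := h.g_Ce _ h.sort_C0
  have sL := h.g_Ue _ sU
  obtain ⟨C, hC⟩ : ∃ C : ℕ → G.V, ∀ i, f^[i] (f G.root) = C i := ⟨_, fun _ => rfl⟩
  obtain ⟨U, hU⟩ : ∃ U : ℕ → G.V, ∀ i, f^[i] (g (f G.root)) = U i := ⟨_, fun _ => rfl⟩
  obtain ⟨L, hL⟩ : ∃ L : ℕ → G.V, ∀ i, f^[i] (g (g (f G.root))) = L i := ⟨_, fun _ => rfl⟩
  have fC : ∀ i, f (C i) = C (i + 1) := fun i => by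
    rw [← hC, ← hC, Function.iterate_succ_apply' f]
  have fU : ∀ i, f (U i) = U (i + 1) := fun i => by
    rw [← hU, ← hU, Function.iterate_succ_apply' f]
  have fL : ∀ i, f (L i) = L (i + 1) := fun i => by
    rw [← hL, ← hL, Function.iterate_succ_apply' f]
  have rC : ∀ i, C i ≠ G.root := fun i => hC i ▸ iterate_ne_root h h.f_Ce h.f_Co h.sort_C0 i
  have rU : ∀ i, U i ≠ G.root := fun i => hU i ▸ iterate_ne_root h h.f_Ue h.f_Uo sU i
  have rL : ∀ i, L i ≠ G.root := fun i => hL i ▸ iterate_ne_root h h.f_Le h.f_Lo sL i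
  have sortC := fun i => hC (2 * i) ▸ hC (2 * i + 1) ▸ sort_iterate hF h.f_Ce h.f_Co h.sort_C0 i
  have sortU := fun i => hU (2 * i) ▸ hU (2 * i + 1) ▸ sort_iterate hF h.f_Ue h.f_Uo sU i
  have sortL := fun i => hL (2 * i) ▸ hL (2 * i + 1) ▸ sort_iterate hF h.f_Le h.f_Lo sL i
  obtain ⟨k, nC⟩ : ∃ k, ∀ i, C i = G.null ↔ 2 * k ≤ i := by
    simp only [← hC]
    refine exists_even_length h h.f_Ce h.f_Co h.sort_C0 ?_
    by_contra hne
    push Not at hne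
    exact h1 (mapsTo_unendingC hF (fun i => by rw [hC]; exact rC i) hne)
  obtain ⟨n, nU⟩ : ∃ n, ∀ i, U i = G.null ↔ 2 * n ≤ i := by
    simp only [← hU]
    refine exists_even_length h h.f_Ue h.f_Uo sU ?_
    by_contra hne
    push Not at hne
    exact h2 (mapsTo_unendingU hF (fun i => by rw [hU]; exact rU i) hne)
  have hk : 2 ≤ k := by
    by_contra hlt
    exact h.ne_null h.sort_C2 ((hC 2).trans ((nC 2).2 (by omega)))
  have sortU' : ∀ i < n, S .Ue (U (2 * i)) ∧ S .Uo (U (2 * i + 1)) := by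
    intro i hi
    rcases sortU i with ⟨e, -⟩ | e
    · rw [nU] at e
      omega
    · exact e
  have sortC' : ∀ i < k, S .Ce (C (2 * i)) ∧ S .Co (C (2 * i + 1)) := by
    intro i hi
    rcases sortC i with ⟨e, -⟩ | e
    · rw [nC] at e
      omega
    · exact e
  have nU' : ∀ i, n ≤ i → U (2 * i) = G.null := fun i hi => (nU _).2 (by omega)
  have odd : ∀ i, g (f (g (U (2 * i)))) = f (U (2 * i)) := by
    intro i
    rcases Nat.lt_or_ge i n with hlt | hge
    · by_contra hne
      exact h4 (mapsTo_badOdd h (W := fun j => U (2 * j)) (hU 0).symm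
        (fun j => by rw [fU, fU]; rfl) (fun j hj => (sortU' j (by omega)).1) hne)
    · rw [nU' i hge, hF.g_null, hF.f_null, hF.g_null]
  have even : ∀ i, f (f (g (U (2 * i)))) = g (f (f (U (2 * i)))) := by
    intro i
    rcases Nat.lt_or_ge i n with hlt | hge
    · by_contra hne
      exact h5 _ (mapsTo_badEven h (W := fun j => U (2 * j)) (hU 0).symm
        (fun j => by rw [fU, fU]; rfl) (fun j hj => (sortU' j (by omega)).1) hne decide_eq_true_iff)
    · rw [nU' i hge, hF.g_null, hF.f_null, hF.f_null, hF.g_null]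
  have gU : ∀ i, g (U (2 * i)) = L (2 * i) := by
    intro i
    induction i with
    | zero => rw [mul_zero, ← hL, ← hU]; rfl
    | succ i ih =>
      have := even i
      rwa [ih, fL, fL, fU, fU, eq_comm] at this
  have gL : ∀ i, g (L (2 * i + 1)) = U (2 * i + 1) := by
    intro i
    have := odd i
    rwa [gU, fL, fU] at this
  have nL : ∀ i, L i = G.null ↔ 2 * n ≤ i := by
    have hev : ∀ i, L (2 * i) = G.null ↔ n ≤ i := by
      intro i
      rw [← gU]
      refine ⟨fun e => ?_, fun hi => by rw [nU' i hi, hF.g_null]⟩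
      by_contra hlt
      exact h.ne_null (h.g_Ue _ (sortU' i (by omega)).1) e
    intro i
    obtain ⟨a, rfl | rfl⟩ : ∃ a, i = 2 * a ∨ i = 2 * a + 1 := ⟨i / 2, by omega⟩
    · rw [hev]
      omega
    · have : L (2 * a + 1) = G.null ↔ L (2 * a) = G.null := by
        rcases sortL a with ⟨e1, e2⟩ | ⟨e1, e2⟩
        · simp [e1, e2]
        · simp [h.ne_null e1, h.ne_null e2]
      rw [this, hev]
      omega
  have sortL' : ∀ i < n, S .Le (L (2 * i)) ∧ S .Lo (L (2 * i + 1)) := by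
    intro i hi
    rcases sortL i with ⟨e, -⟩ | e
    · rw [nL] at e
      omega
    · exact e
  have C1 : C 1 = f (f G.root) := (hC 1).symm
  have L1 : L 1 = f (g (g (f G.root))) := (hL 1).symm
  obtain ⟨u, hu, u0, gCe, mu⟩ := exists_strictMono_index (z := G.null) (k := k) (n := n)
    (v := fun j => g (C (2 * j))) (W := fun t => U (2 * t))
    (fun t => g (g (U (2 * t))) = G.root) (by omega)
    (fun t => by simp only [nU]; omega)
    (fun j => by
      refine ⟨fun e => ?_, fun hj => ?_⟩
      · by_contra hlt
        exact h.ne_null (h.g_Ce _ (sortC' j (by omega)).1) e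
      · simp only [(nC (2 * j)).2 (by omega), hF.g_null])
    (by simp only [mul_zero, ← hC, ← hU]; rfl)
    (by
      simp only [mul_zero, ← hU]
      exact h.ggg_Ce _ h.sort_C0)
    (by
      intro j a b hj hab hbn hv hgap hb
      by_contra hne
      refine h6 true _ (mapsTo_badNext hF (D := fun j => C (2 * j)) (W := fun t => U (2 * t))
        (hC 0).symm (fun j => by rw [fC, fC]; rfl) (fun j => by rw [fU, fU]; rfl)
        (fun j => rC _) (fun j => by rw [fC]; exact rC _) (fun j => rU _)
        (fun j => by rw [fU]; exact rU _) (fun i hi => h.ne_null (sortC' i (by omega)).1)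
        (fun t ht => h.ne_null (sortU' t (by omega)).1) hab hv ?_ ?_ decide_eq_true_iff hne)
      · intro t ht ht'
        have s := h.g_Ue _ (sortU' t (by omega)).1
        exact ⟨h.ne_null s, h.ne_root s, (h.g_Le _ s).resolve_left (hgap t ht ht')⟩
      · intro hn
        refine hb ?_
        rw [Ne, nU] at hn
        omega)
  obtain ⟨l, hl, l0, gCo, ml⟩ := exists_strictMono_index (z := G.null) (k := k) (n := n)
    (v := fun j => g (C (2 * j + 1))) (W := fun t => L (2 * t + 1))
    (fun t => g (g (L (2 * t + 1))) = G.root) (by omega)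
    (fun t => by simp only [nL]; omega)
    (fun j => by
      refine ⟨fun e => ?_, fun hj => ?_⟩
      · by_contra hlt
        exact h.ne_null (h.g_Co _ (sortC' j (by omega)).2) e
      · simp only [(nC (2 * j + 1)).2 (by omega), hF.g_null])
    (by
      by_contra hne
      simp only [mul_zero, zero_add, C1, L1] at hne
      exact h3 (mapsTo_badBase h hne))
    (by
      have : g (f (f G.root)) = f (g (g (f G.root))) := by
        by_contra hne
        exact h3 (mapsTo_badBase h hne)
      simp only [mul_zero, zero_add, L1, ← this]
      exact h.ggg_Co _ (h.f_Ce _ h.sort_C0))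
    (by
      intro j a b hj hab hbn hv hgap hb
      by_contra hne
      refine h6 false _ (mapsTo_badNext hF (D := fun j => C (2 * j + 1))
        (W := fun t => L (2 * t + 1)) C1 (fun j => by rw [fC, fC]; rfl)
        (fun j => by rw [fL, fL]; rfl)
        (fun j => rC _) (fun j => by rw [fC]; exact rC _) (fun j => rL _)
        (fun j => by rw [fL]; exact rL _) (fun i hi => h.ne_null (sortC' i (by omega)).2)
        (fun t ht => h.ne_null (sortL' t (by omega)).2) hab hv ?_ ?_ decide_eq_true_iff hne)
      · intro t ht ht'
        have s := h.g_Lo _ (sortL' t (by omega)).2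
        exact ⟨h.ne_null s, h.ne_root s, (h.g_Uo _ s).resolve_left (hgap t ht ht')⟩
      · intro hn
        refine hb ?_
        rw [Ne, nL] at hn
        omega)
  refine isCorresponder_of_equations hG h hk hC hU hL nC nU nL gU gL u0 hu l0 hl gCe gCo ?_ ?_
  · intro t ht
    rw [← gU]
    exact mu t ht
  · intro t ht
    rw [← gL]
    exact ml t ht

end Recover

/-! ### The seventeen summands -/

/-- The obstructions of the summands of `Q`; the last of them is used for every index from `9`
on. -/
def obstruction : ℕ → Obstruction
  | 0 => .unendingC
  | 1 => .unendingU
  | 2 => .badBase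
  | 3 => .badOdd
  | 4 => .badEven false
  | 5 => .badEven true
  | 6 => .badNext false false
  | 7 => .badNext false true
  | 8 => .badNext true false
  | _ => .badNext true true

theorem isCorresponder_of_not_mapsTo_obstruction {G : RootedGraph.{u}} (hG : G.IsHeap)
    (hP : G.MapsTo colourGraph) (hQ : ∀ i < 17, ¬ G.MapsTo (obstruction i).graph) :
    G.IsCorresponder := by
  obtain ⟨f, g, S, h⟩ := exists_isLayered hG hP
  refine isCorresponder_of_not_mapsTo hG h (hQ 0 (by omega)) (hQ 1 (by omega)) (hQ 2 (by omega))
    (hQ 3 (by omega)) ?_ ?_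
  · rintro (_ | _)
    · exact hQ 4 (by omega)
    · exact hQ 5 (by omega)
  · rintro (_ | _) (_ | _)
    · exact hQ 6 (by omega)
    · exact hQ 7 (by omega)
    · exact hQ 8 (by omega)
    · exact hQ 9 (by omega)

theorem not_corresponderGraph_mapsTo_obstruction {n k : ℕ} (hk : 0 < k) (hn : 0 < n)
    {u l : Fin k → Fin n} (u0 : (u ⟨0, hk⟩ : ℕ) = 0) (hu : StrictMono u)
    (l0 : (l ⟨0, hk⟩ : ℕ) = 0) (hl : StrictMono l) (i : ℕ) :
    ¬ (corresponderGraph n k u l).MapsTo (obstruction i).graph := by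
  intro h
  obtain ⟨cC, cU, cL, h⟩ := Obstruction.exists_isSeqMarking hk h
  rcases i with _ | _ | _ | _ | _ | _ | _ | _ | _ | i
  · exact Obstruction.not_isSeqMarking_unendingC h
  · exact Obstruction.not_isSeqMarking_unendingU hk u0 h
  · exact Obstruction.not_isSeqMarking_badBase hk hn u0 l0 h
  · exact Obstruction.not_isSeqMarking_badOdd hk u0 h
  · exact Obstruction.not_isSeqMarking_badEven _ hk u0 h
  · exact Obstruction.not_isSeqMarking_badEven _ hk u0 h
  · exact Obstruction.not_isSeqMarking_badNext_false _ hk hl h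
  · exact Obstruction.not_isSeqMarking_badNext_false _ hk hl h
  · exact Obstruction.not_isSeqMarking_badNext_true _ hu h
  · exact Obstruction.not_isSeqMarking_badNext_true _ hu h

end RootedGraph

theorem mainTheorem2 :
    ∃ (P : RootedGraph.{0}) (Q : Fin 17 → RootedGraph.{0}),
      P.IsOrable ∧ (∀ i, (Q i).IsOrable) ∧ (RootedGraph.finSum 16 Q).IsOrable ∧
      ∀ G₀ : RootedGraph.{u},
        (G₀.IsHeap ∧ G₀.MapsTo P ∧ ¬ G₀.MapsTo (RootedGraph.finSum 16 Q)) ↔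
          G₀.IsCorresponder := by
  open RootedGraph in
  have hQ : ∀ i : Fin 17, (obstruction i).graph.IsOrable := fun i => isOrable_ofRules _ _ _ _
  refine ⟨colourGraph, fun i => (obstruction i).graph, isOrable_ofRules _ _ _ _, hQ,
    isOrable_finSum 16 _ hQ, fun G₀ => ⟨?_, ?_⟩⟩
  · rintro ⟨hG, hP, hnQ⟩
    exact isCorresponder_of_not_mapsTo_obstruction hG hP fun i hi h =>
      hnQ (h.trans (mapsTo_finSum 16 (fun i : Fin 17 => (obstruction i).graph) ⟨i, hi⟩))
  · rintro ⟨n, k, hn, hk, u, l, u0, hu, l0, hl, e⟩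
    have hheap := isHeap_corresponderGraph (by omega) u l u0
    refine ⟨e.isHeap hheap, e.mapsTo.trans (corresponderGraph_mapsTo_colourGraph hk u l),
      fun h => ?_⟩
    obtain ⟨i, hi⟩ := exists_mapsTo_of_finSum (c := CNode.C ⟨0, by omega⟩) hheap CEdge2.root
      (CEdge1.root (by omega)) (by simp [corresponderGraph]) (by simp [corresponderGraph]) 16 _ hQ
      (e.symm.mapsTo.trans h)
    exact not_corresponderGraph_mapsTo_obstruction (by omega) (by omega) u0 hu l0 hl i hi
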